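/- Work with $N=3$ electrons in $\mathbb R^3$ and Coulomb cost $C(r_1,r_2,r_3)=\sum_{1\le i<j\le 3}\frac1{|r_i-r_j|}$ (equal to $+\infty$ at coincidences). For $a,\varepsilon>0$ let $\rho_{a,\varepsilon}$ be the spherically symmetric density $$\rho_{a,\varepsilon}(r)=\frac{3}{4\pi a\varepsilon}\,\frac1{r^2}\quad(a\le r\le(1+\varepsilon)a),\qquad \rho_{a,\varepsilon}(r)=0\ \text{ otherwise.}$$ *Strong-interaction value.* $V_{ee}^{\rm SIL}[\rho]=\inf_\gamma\int C\,d\gamma$, where $\gamma$ runs over the probability measures on $(\mathbb R^3)^3$ that are invariant under permutations of the three coordinates and have all marginals equal to $\rho/3$. *SGS value.* Let $V(r_1,r_2,r_3)$ be the minimum of $C$ over configurations with prescribed radii $|\mathbf r_i|=r_i$, let $N_e(r)=\int_0^r4\pi s^2\rho(s)\,ds$, and let $R_e=N_e^{-1}$ be its inverse, with values in $\{r\ge0:\rho(r)\neq0\}$. Put $f_1(r)=r$, $$f_2(r)=\begin{cases}R_e(2-N_e(r)),&r\le R_e(2),\\R_e(N_e(r)-2),&r>R_e(2),\end{cases}\qquad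 f_3(r)=\begin{cases}R_e(N_e(r)+2),&r<R_e(1),\\R_e(4-N_e(r)),&r\ge R_e(1),\end{cases}$$ and $V_{ee}^{\rm SGS}[\rho]=\int_0^\infty4\pi r^2\,\frac{\rho(r)}3\,V\big(f_1(r),f_2(r),f_3(r)\big)\,dr$. SGS co-motion maps for $\rho$ are maps $x\mapsto(F_1(x),F_2(x),F_3(x))$ such that, whenever $\rho(|x|)\ne0$, $F_1(x)=x$, $|F_n(x)|=f_n(|x|)$ for $n=1,2,3$, and $C(F_1(x),F_2(x),F_3(x))$ is minimal among all configurations with these radii. **Theorem.** There are $\varepsilon_0>0$ and implied constants, all independent of $a$, such that for all $a>0$ and $0<\varepsilon<\varepsilon_0$ the value $V_{ee}^{\rm SGS}[\rho_{a,\varepsilon}]$ is finite and $$V_{ee}^{\rm SGS}[\rho_{a,\varepsilon}]=\frac{\sqrt3}{a}\Big[1-\frac{\varepsilon}{2}+\frac{7}{27}\varepsilon^2+O(\varepsilon^3)\Big],$$ $$V_{ee}^{\rm SIL}[\rho_{a,\varepsilon}]=\frac{\sqrt3}{a}\Big[1-\frac{\varepsilon}{2}+\frac{31}{120}\varepsilon^2+O(\varepsilon^3)\Big],$$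 $$V_{ee}^{\rm SGS}[\rho_{a,\varepsilon}]=V_{ee}^{\rm SIL}[\rho_{a,\varepsilon}]+\frac{\sqrt3}{1080}\,\frac{\varepsilon^2}{a}+\frac{\sqrt3}{a}\,O(\varepsilon^3).$$ Moreover, for these $a,\varepsilon$ the SGS maps are not optimal: $V_{ee}^{\rm SIL}[\rho_{a,\varepsilon}]<V_{ee}^{\rm SGS}[\rho_{a,\varepsilon}]$; SGS co-motion maps $F$ for $\rho_{a,\varepsilon}$ exist, and all of them satisfy $$\int_{\mathbb R^3}\frac{\rho_{a,\varepsilon}(|x|)}3\,C\big(F_1(x),F_2(x),F_3(x)\big)\,dx=V_{ee}^{\rm SGS}[\rho_{a,\varepsilon}]>V_{ee}^{\rm SIL}[\rho_{a,\varepsilon}].$$ -/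

import Mathlib

open MeasureTheory
open scoped ENNReal

noncomputable section

/-- The position space `ℝ³` of one electron, with its Euclidean norm. -/
abbrev E3 : Type := EuclideanSpace ℝ (Fin 3)

/-- The Coulomb cost `∑_{i<j} 1/|r_i - r_j|` of `N` electrons, equal to `∞` at coincidences. -/
def coulombCost {N : ℕ} (p : Fin N → E3) : ℝ≥0∞ :=
  ∑ i : Fin N, ∑ j ∈ Finset.Ioi i, (edist (p i) (p j))⁻¹

/-- The reduced radial cost `V(r_1, …, r_N)`: the smallest Coulomb cost at fixed radii. -/
def reducedCost {N : ℕ} (r : Fin N → ℝ) : ℝ≥0∞ :=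
  ⨅ p ∈ {p : Fin N → E3 | ∀ i, ‖p i‖ = r i}, coulombCost p

/-- The probability measure `ρ/N` on `ℝ³`, for a radial profile `ρ` of an `N`-electron density. -/
def singleParticleLaw (N : ℕ) (ρ : ℝ → ℝ) : Measure E3 :=
  (N : ℝ≥0∞)⁻¹ • (volume : Measure E3).withDensity (fun x => ENNReal.ofReal (ρ ‖x‖))

/-- The symmetric transport plans `Π(ℝ^{3N}, ρ)`: probability measures on configurations that are
invariant under exchange of the electrons and have all marginals equal to `ρ/N`. -/
def symmetricPlans (N : ℕ) (ρ : ℝ → ℝ) : Set (Measure (Fin N → E3)) :=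
  {γ | IsProbabilityMeasure γ ∧
    (∀ σ : Equiv.Perm (Fin N), γ.map (fun p => p ∘ σ) = γ) ∧
    ∀ i : Fin N, γ.map (fun p => p i) = singleParticleLaw N ρ}

/-- The strong-interaction value `V_ee^SIL[ρ]`: the optimal value of the symmetric multi-marginal
transport problem with Coulomb cost. -/
def VSIL (N : ℕ) (ρ : ℝ → ℝ) : ℝ≥0∞ :=
  ⨅ γ ∈ symmetricPlans N ρ, ∫⁻ p, coulombCost p ∂γ

/-- The radial cumulative distribution `N_e(r) = ∫_0^r 4π s² ρ(s) ds`. -/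
def radialCount (ρ : ℝ → ℝ) (r : ℝ) : ℝ :=
  ∫ s in (0 : ℝ)..r, 4 * Real.pi * s ^ 2 * ρ s

/-- The inverse `R_e` of `N_e`, with values in the radii that carry the density. -/
def radialQuantile (ρ : ℝ → ℝ) (ν : ℝ) : ℝ :=
  Function.invFunOn (radialCount ρ) {r | 0 ≤ r ∧ ρ r ≠ 0} ν

/-- The radial SGS co-motion function `f_n(r)`, for `n = 1, …, N`. -/
def sgsRadial (N : ℕ) (ρ : ℝ → ℝ) (n : ℕ) (r : ℝ) : ℝ :=
  if Even n then
    if r ≤ radialQuantile ρ n then radialQuantile ρ (n - radialCount ρ r)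
    else radialQuantile ρ (radialCount ρ r - n)
  else
    if r < radialQuantile ρ ((N : ℝ) - n + 1) then radialQuantile ρ (radialCount ρ r + n - 1)
    else radialQuantile ρ (2 * N + 1 - n - radialCount ρ r)

/-- The radii `(f_1(r), …, f_N(r))`. -/
def sgsRadii (N : ℕ) (ρ : ℝ → ℝ) (r : ℝ) : Fin N → ℝ :=
  fun i => sgsRadial N ρ (i.val + 1) r

/-- The SGS value `V_ee^SGS[ρ] = ∫_0^∞ 4π r² (ρ(r)/N) V(f_1(r), …, f_N(r)) dr`. -/
def VSGS (N : ℕ) (ρ : ℝ → ℝ) : ℝ≥0∞ :=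
  ∫⁻ r in Set.Ioi (0 : ℝ),
    ENNReal.ofReal (4 * Real.pi * r ^ 2 * (ρ r / N)) * reducedCost (sgsRadii N ρ r)

/-- The value `∫ (ρ(x)/N) ∑_{i<j} 1/|f_i(x) - f_j(x)| dx` of a family of co-motion functions;
`F x i` is the position of electron `i` when the reference electron is at `x`. -/
def sceValue (N : ℕ) (ρ : ℝ → ℝ) (F : E3 → Fin N → E3) : ℝ≥0∞ :=
  ∫⁻ x : E3, ENNReal.ofReal (ρ ‖x‖ / N) * coulombCost (F x)

/-- `F` is a family of vectorial SGS co-motion functions: wherever the density is nonzero, the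
first electron is at `x`, the radii are `f_n(|x|)`, and the angles are optimal for these radii. -/
def IsSGSComotion (N : ℕ) (ρ : ℝ → ℝ) (F : E3 → Fin N → E3) : Prop :=
  ∀ x : E3, ρ ‖x‖ ≠ 0 →
    (∀ i : Fin N, i.val = 0 → F x i = x) ∧
    (∀ i : Fin N, ‖F x i‖ = sgsRadii N ρ ‖x‖ i) ∧
    ∀ q : Fin N → E3, (∀ i, ‖q i‖ = sgsRadii N ρ ‖x‖ i) → coulombCost (F x) ≤ coulombCost q

/-- The radial profile of the three-electron thin-shell density `ρ_{a,ε}`. -/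
def shellDensity (a ε r : ℝ) : ℝ :=
  if a ≤ r ∧ r ≤ (1 + ε) * a then 3 / (4 * Real.pi * a * ε) * (1 / r ^ 2) else 0

end

/-! For `s > 0`, convexity of `t ↦ t ^ (-1/2)` in `t = d ^ 2` gives `1 / d ≥ (3 / 2) s - (1 / 2) s ^
3 d ^ 2`, with equality at `s d = 1`. Take `s = κ n_i n_j` for each pair and put `w_i = n_i ^ 3`.
The sum of the `w_i w_j d_ij ^ 2` depends only on the radii, up to the term `-‖∑ w_i p_i‖ ^ 2`.
Every choice of multipliers `n` therefore bounds the cost below by `dualValue`, at all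
configurations with the given radii. The bound is almost attained when `∑ w_i p_i = 0` and each `s
d` is close to 1. Write the radii as `a (1 + u_i ε)`, so that each `u_i` is uniform on `[0, 1]`
under the density. First-order multipliers leave a defect `O(ε ^ 2)` in `s d = 1`, which costs only
`O(ε ^ 4)`. Hence the reduced cost is `√3 / a * (shellQuad ε u + O(ε ^ 3))`, uniformly in `u`
(`shell_cost_bounds`). In `shellQuad` the marginals fix the mean of everything except `ε ^ 2 S ^ 2 /
10`, where `S = u_0 + u_1 + u_2` has mean `3 / 2`. The strong-interaction problem minimises this
term by making `S` constant, which `uniformTriple` achieves; `S ^ 2 ≥ 3 S - 9 / 4` gives the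
matching bound (`VSIL_shell_le`, `le_VSIL_shell`). For the SGS maps `S` is uniform on `[4/3, 5/3]`
with variance `1 / 108`, whence the gap `ε ^ 2 / 1080` (`integral_shellQuad_sgsTriple`). -/

/-! ### Second-order expansions with uniform remainders -/

/-- `f ε v` has the second-order expansion `c₀ + c₁ ε + c₂ ε²` in `ε`, with a remainder `ε³ R` in
which `R` is jointly continuous. -/
def HasJet (f : ℝ → (Fin 3 → ℝ) → ℝ) (c₀ c₁ c₂ : (Fin 3 → ℝ) → ℝ) : Prop :=
  Continuous c₀ ∧ Continuous c₁ ∧ Continuous c₂ ∧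
    ∃ R : ℝ × (Fin 3 → ℝ) → ℝ, Continuous R ∧
      ∀ ε v, f ε v = c₀ v + c₁ v * ε + c₂ v * ε ^ 2 + ε ^ 3 * R (ε, v)

namespace HasJet

variable {f g : ℝ → (Fin 3 → ℝ) → ℝ} {c₀ c₁ c₂ d₀ d₁ d₂ : (Fin 3 → ℝ) → ℝ}

theorem affine (hc : Continuous c₀) (hd : Continuous c₁) :
    HasJet (fun ε v => c₀ v + c₁ v * ε) c₀ c₁ 0 :=
  ⟨hc, hd, continuous_const, 0, continuous_const, fun ε v => by simp⟩

theorem const (c : ℝ) : HasJet (fun _ _ => c) (fun _ => c) 0 0 :=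
  ⟨continuous_const, continuous_const, continuous_const, 0, continuous_const, fun ε v => by simp⟩

theorem add (hf : HasJet f c₀ c₁ c₂) (hg : HasJet g d₀ d₁ d₂) :
    HasJet (fun ε v => f ε v + g ε v) (fun v => c₀ v + d₀ v) (fun v => c₁ v + d₁ v)
      (fun v => c₂ v + d₂ v) := by
  obtain ⟨h0, h1, h2, R, hR, hf⟩ := hf
  obtain ⟨k0, k1, k2, S, hS, hg⟩ := hg
  refine ⟨h0.add k0, h1.add k1, h2.add k2, fun z => R z + S z, hR.add hS, fun ε v => ?_⟩
  simp only [hf, hg]; ring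

theorem mul (hf : HasJet f c₀ c₁ c₂) (hg : HasJet g d₀ d₁ d₂) :
    HasJet (fun ε v => f ε v * g ε v) (fun v => c₀ v * d₀ v) (fun v => c₀ v * d₁ v + c₁ v * d₀ v)
      (fun v => c₀ v * d₂ v + c₁ v * d₁ v + c₂ v * d₀ v) := by
  obtain ⟨h0, h1, h2, R, hR, hf⟩ := hf
  obtain ⟨k0, k1, k2, S, hS, hg⟩ := hg
  refine ⟨by fun_prop, by fun_prop, by fun_prop,
    fun z => c₁ z.2 * d₂ z.2 + c₂ z.2 * d₁ z.2 + c₂ z.2 * d₂ z.2 * z.1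
      + R z * (d₀ z.2 + d₁ z.2 * z.1 + d₂ z.2 * z.1 ^ 2)
      + S z * (c₀ z.2 + c₁ z.2 * z.1 + c₂ z.2 * z.1 ^ 2) + z.1 ^ 3 * (R z * S z),
    by fun_prop, fun ε v => ?_⟩
  simp only [hf, hg]; ring

theorem sub (hf : HasJet f c₀ c₁ c₂) (hg : HasJet g d₀ d₁ d₂) :
    HasJet (fun ε v => f ε v - g ε v) (fun v => c₀ v - d₀ v) (fun v => c₁ v - d₁ v)
      (fun v => c₂ v - d₂ v) := by
  obtain ⟨h0, h1, h2, R, hR, hf⟩ := hf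
  obtain ⟨k0, k1, k2, S, hS, hg⟩ := hg
  refine ⟨h0.sub k0, h1.sub k1, h2.sub k2, fun z => R z - S z, hR.sub hS, fun ε v => ?_⟩
  simp only [hf, hg]; ring

theorem square (hf : HasJet f c₀ c₁ c₂) :
    HasJet (fun ε v => f ε v ^ 2) (fun v => c₀ v * c₀ v) (fun v => c₀ v * c₁ v + c₁ v * c₀ v)
      (fun v => c₀ v * c₂ v + c₁ v * c₁ v + c₂ v * c₀ v) := by
  simpa only [pow_two] using hf.mul hf

theorem cube (hf : HasJet f c₀ c₁ c₂) :
    HasJet (fun ε v => f ε v ^ 3) (fun v => c₀ v * c₀ v * c₀ v)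
      (fun v => c₀ v * c₀ v * c₁ v + (c₀ v * c₁ v + c₁ v * c₀ v) * c₀ v)
      (fun v => c₀ v * c₀ v * c₂ v + (c₀ v * c₁ v + c₁ v * c₀ v) * c₁ v
        + (c₀ v * c₂ v + c₁ v * c₁ v + c₂ v * c₀ v) * c₀ v) := by
  simpa only [pow_succ, pow_zero, one_mul] using (hf.mul hf).mul hf

/-- The continuous remainder is bounded on the compact set `[0, 1] × [0, 1] ^ 3`, which makes the
error uniform in the shell coordinates. -/
theorem bound (hf : HasJet f c₀ c₁ c₂) :
    ∃ K : ℝ, 0 ≤ K ∧ ∀ ε ∈ Set.Icc (0 : ℝ) 1, ∀ v ∈ Set.Icc (0 : Fin 3 → ℝ) 1,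
      |f ε v - (c₀ v + c₁ v * ε + c₂ v * ε ^ 2)| ≤ K * ε ^ 3 := by
  obtain ⟨h0, h1, h2, R, hR, hf⟩ := hf
  obtain ⟨K, hK⟩ := ((isCompact_Icc (a := (0 : ℝ)) (b := 1)).prod
    (isCompact_Icc (a := (0 : Fin 3 → ℝ)) (b := 1))).exists_bound_of_continuousOn hR.continuousOn
  refine ⟨|K|, abs_nonneg K, fun ε hε v hv => ?_⟩
  have := (hK (ε, v) ⟨hε, hv⟩).trans (le_abs_self K)
  rw [hf, add_sub_cancel_left, abs_mul, abs_of_nonneg (pow_nonneg hε.1 3), mul_comm]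
  exact mul_le_mul_of_nonneg_right this (pow_nonneg hε.1 3)

theorem bound_of_eq_zero (hf : HasJet f c₀ c₁ c₂) (h₀ : ∀ v, c₀ v = 0) (h₁ : ∀ v, c₁ v = 0) :
    ∃ K : ℝ, 0 ≤ K ∧ ∀ ε ∈ Set.Icc (0 : ℝ) 1, ∀ v ∈ Set.Icc (0 : Fin 3 → ℝ) 1,
      |f ε v| ≤ K * ε ^ 2 := by
  obtain ⟨-, -, h2, R, hR, hf⟩ := hf
  obtain ⟨K, hK⟩ := ((isCompact_Icc (a := (0 : ℝ)) (b := 1)).prod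
    (isCompact_Icc (a := (0 : Fin 3 → ℝ)) (b := 1))).exists_bound_of_continuousOn
    (f := fun z => c₂ z.2 + z.1 * R z) (by fun_prop)
  refine ⟨|K|, abs_nonneg K, fun ε hε v hv => ?_⟩
  have := (hK (ε, v) ⟨hε, hv⟩).trans (le_abs_self K)
  have e : f ε v = (c₂ v + ε * R (ε, v)) * ε ^ 2 := by rw [hf, h₀, h₁]; ring
  rw [e, abs_mul, abs_of_nonneg (pow_nonneg hε.1 2)]
  exact mul_le_mul_of_nonneg_right this (pow_nonneg hε.1 2)

end HasJet

/-! ### Dual multipliers and the expansion of the dual value -/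

/-- The normalised multipliers of the dual problem, to first order in the shell thickness. -/
noncomputable def shellWeight (ε : ℝ) (u : Fin 3 → ℝ) (i : Fin 3) : ℝ :=
  1 + -((u 0 + u 1 + u 2 + 12 * u i) / 30) * ε

/-- The normalised dual value of three electrons with radii `x` for the multipliers `n`. -/
noncomputable def dualValue (n x : Fin 3 → ℝ) : ℝ :=
  1 / 2 * (n 0 * n 1 + n 0 * n 2 + n 1 * n 2)
    - 1 / 18 * ((n 0 ^ 3 + n 1 ^ 3 + n 2 ^ 3)
      * (x 0 ^ 2 * n 0 ^ 3 + x 1 ^ 2 * n 1 ^ 3 + x 2 ^ 2 * n 2 ^ 3))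

/-- The radii, in units of the inner radius, of electrons with shell coordinates `u`. -/
noncomputable def shellRadius (ε : ℝ) (u : Fin 3 → ℝ) (i : Fin 3) : ℝ := 1 + u i * ε

/-- The second-order expansion of the reduced cost in a thin shell. -/
noncomputable def shellQuad (ε : ℝ) (u : Fin 3 → ℝ) : ℝ :=
  1 - ε * (u 0 + u 1 + u 2) / 3
    + ε ^ 2 * ((u 0 ^ 2 + u 1 ^ 2 + u 2 ^ 2) / 30 + (u 0 + u 1 + u 2) ^ 2 / 10)

/-- The defect in the optimality condition for the distance between electrons `i` and `j` in the
configuration that is balanced by the weights `n ^ 3`. -/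
noncomputable def stationarityDefect (n x : Fin 3 → ℝ) (i j k : Fin 3) : ℝ :=
  n i ^ 3 * n j ^ 3 * (x i ^ 2 + x j ^ 2) - n k ^ 3 * n k ^ 3 * x k ^ 2 + n i ^ 3 * n i ^ 3 * x i ^ 2
    + n j ^ 3 * n j ^ 3 * x j ^ 2 - 3 * (n i * n j)

theorem hasJet_shellWeight (i : Fin 3) :
    HasJet (fun ε u => shellWeight ε u i) (fun _ => 1)
      (fun u => -((u 0 + u 1 + u 2 + 12 * u i) / 30)) 0 :=
  HasJet.affine (by fun_prop) (by fun_prop)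

theorem hasJet_shellRadius (i : Fin 3) :
    HasJet (fun ε u => shellRadius ε u i) (fun _ => 1) (fun u => u i) 0 :=
  HasJet.affine (by fun_prop) (by fun_prop)

/-- First-order multipliers suffice for a second-order value, because `dualValue` is stationary in
`n` at the optimal multipliers. -/
theorem dualValue_shell_bound :
    ∃ K : ℝ, 0 ≤ K ∧ ∀ ε ∈ Set.Icc (0 : ℝ) 1, ∀ u ∈ Set.Icc (0 : Fin 3 → ℝ) 1,
      |dualValue (shellWeight ε u) (shellRadius ε u) - shellQuad ε u| ≤ K * ε ^ 3 := by
  have n := hasJet_shellWeight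
  have x := hasJet_shellRadius
  have h := ((HasJet.const (1 / 2)).mul ((((n 0).mul (n 1)).add ((n 0).mul (n 2))).add
      ((n 1).mul (n 2)))).sub ((HasJet.const (1 / 18)).mul
      ((((n 0).cube.add (n 1).cube).add (n 2).cube).mul
        ((((x 0).square.mul (n 0).cube).add ((x 1).square.mul (n 1).cube)).add
          ((x 2).square.mul (n 2).cube))))
  obtain ⟨K, hK, hb⟩ := h.bound
  refine ⟨K, hK, fun ε hε u hu => ?_⟩
  convert hb ε hε u hu using 2
  simp only [dualValue, shellQuad, Pi.zero_apply]
  ring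

/-- The coefficients of `shellWeight` are those for which this first-order term vanishes: with `n_i
= 1 + ν_i ε` it reads `9 (ν_i + ν_j) - 6 ν_k + 4 (u_i + u_j) - 2 u_k`. The hypothesis `hijk` encodes
that `i, j, k` exhaust the three indices. -/
theorem stationarityDefect_shell_bound (i j k : Fin 3) (hijk : ∀ u : Fin 3 → ℝ,
    u 0 + u 1 + u 2 = u i + u j + u k) :
    ∃ K : ℝ, 0 ≤ K ∧ ∀ ε ∈ Set.Icc (0 : ℝ) 1, ∀ u ∈ Set.Icc (0 : Fin 3 → ℝ) 1,
      |stationarityDefect (shellWeight ε u) (shellRadius ε u) i j k| ≤ K * ε ^ 2 := by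
  have n := hasJet_shellWeight
  have x := hasJet_shellRadius
  have h := ((((((n i).cube.mul (n j).cube).mul ((x i).square.add (x j).square)).sub
      (((n k).cube.mul (n k).cube).mul (x k).square)).add
      (((n i).cube.mul (n i).cube).mul (x i).square)).add
      (((n j).cube.mul (n j).cube).mul (x j).square)).sub
      ((HasJet.const 3).mul ((n i).mul (n j)))
  refine h.bound_of_eq_zero (fun u => by norm_num) (fun u => ?_)
  simp only [Pi.zero_apply, hijk u]
  ring

theorem shellWeight_mem {ε : ℝ} (hε : ε ∈ Set.Icc (0 : ℝ) 1) {u : Fin 3 → ℝ}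
    (hu : u ∈ Set.Icc (0 : Fin 3 → ℝ) 1) (i : Fin 3) :
    shellWeight ε u i ∈ Set.Icc (1 - ε / 2) 1 := by
  have h0 : ∀ j, 0 ≤ u j := hu.1
  have h1 : ∀ j, u j ≤ 1 := hu.2
  have a : 0 ≤ (u 0 + u 1 + u 2 + 12 * u i) / 30 := by
    linarith [h0 0, h0 1, h0 2, h0 i]
  have b : (u 0 + u 1 + u 2 + 12 * u i) / 30 ≤ 1 / 2 := by
    linarith [h1 0, h1 1, h1 2, h1 i]
  have := mul_le_mul_of_nonneg_right b hε.1
  have := mul_nonneg a hε.1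
  constructor <;> simp only [shellWeight] <;> linarith

theorem shellRadius_mem {ε : ℝ} (hε : 0 ≤ ε) {u : Fin 3 → ℝ}
    (hu : u ∈ Set.Icc (0 : Fin 3 → ℝ) 1) (i : Fin 3) :
    shellRadius ε u i ∈ Set.Icc 1 (1 + ε) := by
  have h0 : 0 ≤ u i := hu.1 i
  have h1 : u i ≤ 1 := hu.2 i
  have := mul_le_mul_of_nonneg_right h1 hε
  have := mul_nonneg h0 hε
  constructor <;> simp only [shellRadius] <;> linarith

/-! ### Tangent bounds for the Coulomb cost -/

theorem coulombCost_three (p : Fin 3 → E3) :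
    coulombCost p = (edist (p 0) (p 1))⁻¹ + (edist (p 0) (p 2))⁻¹ + (edist (p 1) (p 2))⁻¹ := by
  have h0 : Finset.Ioi (0 : Fin 3) = {1, 2} := by decide
  have h1 : Finset.Ioi (1 : Fin 3) = {2} := by decide
  have h2 : Finset.Ioi (2 : Fin 3) = ∅ := by decide
  simp [coulombCost, Fin.sum_univ_three, h0, h1, h2]

theorem ofReal_tangent_le_edist_inv (x y : E3) {s : ℝ} (hs : 0 < s) :
    ENNReal.ofReal (3 / 2 * s - 1 / 2 * s ^ 3 * dist x y ^ 2) ≤ (edist x y)⁻¹ := by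
  rcases (dist_nonneg (x := x) (y := y)).eq_or_lt with h | h
  · simp [edist_dist, ← h]
  · rw [edist_dist, ← ENNReal.ofReal_inv_of_pos h]
    refine ENNReal.ofReal_le_ofReal ?_
    set d := dist x y
    rw [← sub_nonneg]
    have : d⁻¹ - (3 / 2 * s - 1 / 2 * s ^ 3 * d ^ 2) = (s * d - 1) ^ 2 * (s * d + 2) / (2 * d) := by
      field_simp; ring
    rw [this]; positivity

/-- A converse to the tangent inequality: away from small `s d`, the loss is quadratic in `(s d) ^ 2
- 1`. -/
theorem edist_inv_le_ofReal (x y : E3) {s : ℝ} (hs : 0 < s) (hd : 1 / 4 ≤ (s * dist x y) ^ 2) :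
    (edist x y)⁻¹ ≤ ENNReal.ofReal (3 / 2 * s - 1 / 2 * s ^ 3 * dist x y ^ 2
      + 2 * s * ((s * dist x y) ^ 2 - 1) ^ 2) := by
  have h : 0 < dist x y := by
    refine dist_nonneg.lt_of_ne fun h => ?_
    rw [← h] at hd; norm_num at hd
  rw [edist_dist, ← ENNReal.ofReal_inv_of_pos h]
  refine ENNReal.ofReal_le_ofReal ?_
  set d := dist x y
  set t := s * d with ht
  have ht2 : 1 / 2 ≤ t := by nlinarith [mul_pos hs h]
  have e : (3 / 2 * s - 1 / 2 * s ^ 3 * d ^ 2 + 2 * s * (t ^ 2 - 1) ^ 2) - d⁻¹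
      = (t - 1) ^ 2 * (4 * t * (t + 1) ^ 2 - (t + 2)) / (2 * d) := by
    rw [ht]; field_simp; ring
  rw [← sub_nonneg, e]
  have : 0 ≤ 4 * t * (t + 1) ^ 2 - (t + 2) := by
    nlinarith [sq_nonneg t, mul_nonneg (sq_nonneg t) (by linarith : 0 ≤ t)]
  positivity

theorem sum_weighted_dist_sq (p : Fin 3 → E3) (w : Fin 3 → ℝ) :
    w 0 * w 1 * dist (p 0) (p 1) ^ 2 + w 0 * w 2 * dist (p 0) (p 2) ^ 2
        + w 1 * w 2 * dist (p 1) (p 2) ^ 2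
      = (w 0 + w 1 + w 2) * (w 0 * ‖p 0‖ ^ 2 + w 1 * ‖p 1‖ ^ 2 + w 2 * ‖p 2‖ ^ 2)
        - ‖w 0 • p 0 + w 1 • p 1 + w 2 • p 2‖ ^ 2 := by
  simp only [dist_eq_norm, norm_sub_sq_real, norm_add_sq_real, inner_add_left, real_inner_smul_left,
    real_inner_smul_right, norm_smul, mul_pow, Real.norm_eq_abs, sq_abs]
  ring

/-- The common scale of the multipliers of the dual problem. -/
noncomputable def dualScale (a : ℝ) : ℝ := √3 / (3 * a)

theorem dualScale_pos {a : ℝ} (ha : 0 < a) : 0 < dualScale a := by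
  unfold dualScale; positivity

theorem dualScale_sq {a : ℝ} (ha : 0 < a) : dualScale a ^ 2 * a ^ 2 = 1 / 3 := by
  unfold dualScale
  have := Real.sq_sqrt (show (0 : ℝ) ≤ 3 by norm_num)
  field_simp
  rw [this]

/-- The product form `κ n_i n_j` of the tangent points makes the coefficients of the squared
distances products `w_i w_j`, so that the weighted parallel-axis identity `sum_weighted_dist_sq`
applies. -/
theorem sum_tangent_eq {a : ℝ} (ha : 0 < a) (n x : Fin 3 → ℝ) (p : Fin 3 → E3)
    (hp : ∀ i, ‖p i‖ = a * x i) :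
    let κ := dualScale a
    (3 / 2 * (κ * (n 0 * n 1)) - 1 / 2 * (κ * (n 0 * n 1)) ^ 3 * dist (p 0) (p 1) ^ 2)
      + (3 / 2 * (κ * (n 0 * n 2)) - 1 / 2 * (κ * (n 0 * n 2)) ^ 3 * dist (p 0) (p 2) ^ 2)
      + (3 / 2 * (κ * (n 1 * n 2)) - 1 / 2 * (κ * (n 1 * n 2)) ^ 3 * dist (p 1) (p 2) ^ 2)
    = √3 / a * dualValue n x
      + 1 / 2 * κ ^ 3 * ‖n 0 ^ 3 • p 0 + n 1 ^ 3 • p 1 + n 2 ^ 3 • p 2‖ ^ 2 := by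
  intro κ
  have h := sum_weighted_dist_sq p (fun i => n i ^ 3)
  simp only [hp] at h
  have hκ : √3 / a = 3 * κ := by simp only [κ, dualScale]; field_simp
  have hs : κ ^ 2 * a ^ 2 = 1 / 3 := dualScale_sq ha
  simp only [dualValue, hκ]
  linear_combination (-(1 / 2) * κ ^ 3) * h - (1 / 2) * κ * (n 0 ^ 3 + n 1 ^ 3 + n 2 ^ 3)
      * (x 0 ^ 2 * n 0 ^ 3 + x 1 ^ 2 * n 1 ^ 3 + x 2 ^ 2 * n 2 ^ 3) * hs

theorem dualValue_le_coulombCost {a : ℝ} (ha : 0 < a) {n x : Fin 3 → ℝ} (hn : ∀ i, 0 < n i)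
    {p : Fin 3 → E3} (hp : ∀ i, ‖p i‖ = a * x i) :
    ENNReal.ofReal (√3 / a * dualValue n x) ≤ coulombCost p := by
  have hκ := dualScale_pos ha
  have h := sum_tangent_eq ha n x p hp
  have hs : ∀ i j, 0 < dualScale a * (n i * n j) := fun i j => mul_pos hκ (mul_pos (hn i) (hn j))
  rw [coulombCost_three]
  calc _ ≤ ENNReal.ofReal _ := ENNReal.ofReal_le_ofReal (by
          refine le_trans ?_ h.ge
          exact le_add_of_nonneg_right (by positivity))
    _ ≤ _ := ENNReal.ofReal_add_le.trans (add_le_add ENNReal.ofReal_add_le le_rfl)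
    _ ≤ _ := add_le_add (add_le_add (ofReal_tangent_le_edist_inv _ _ (hs 0 1))
      (ofReal_tangent_le_edist_inv _ _ (hs 0 2))) (ofReal_tangent_le_edist_inv _ _ (hs 1 2))

/-- Balance determines the inner product of `p i` and `p j` from the three radii, by comparing `‖w_i
p_i + w_j p_j‖` with `‖w_k p_k‖`. Vanishing defect thus means that the distance is exactly the
tangent point. -/
theorem balanced_dist_sq {a : ℝ} (ha : 0 < a) {n x : Fin 3 → ℝ} {i j k : Fin 3}
    {p : Fin 3 → E3} (hp : ∀ i, ‖p i‖ = a * x i)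
    (hb : n i ^ 3 • p i + n j ^ 3 • p j + n k ^ 3 • p k = 0) :
    n i * n j * ((dualScale a * (n i * n j) * dist (p i) (p j)) ^ 2 - 1)
      = stationarityDefect n x i j k / 3 := by
  have h1 : ‖n i ^ 3 • p i + n j ^ 3 • p j‖ ^ 2 = ‖n k ^ 3 • p k‖ ^ 2 := by
    rw [eq_neg_of_add_eq_zero_left hb, norm_neg]
  simp only [norm_add_sq_real, real_inner_smul_left,
    real_inner_smul_right, norm_smul, mul_pow, Real.norm_eq_abs, sq_abs, hp] at h1
  have h2 : dist (p i) (p j) ^ 2 = a ^ 2 * (x i ^ 2 + x j ^ 2) - 2 * inner ℝ (p i) (p j) := by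
    rw [dist_eq_norm, norm_sub_sq_real, hp, hp]; ring
  have hs := dualScale_sq ha
  rw [mul_pow, h2, stationarityDefect]
  linear_combination (-dualScale a ^ 2) * h1 + (n i ^ 3 * n j ^ 3 * (x i ^ 2 + x j ^ 2)
    - n k ^ 3 * n k ^ 3 * x k ^ 2 + n i ^ 3 * n i ^ 3 * x i ^ 2 + n j ^ 3 * n j ^ 3 * x j ^ 2) * hs

theorem coulombCost_le_dualValue {a δ : ℝ} (ha : 0 < a) (hδ : δ ≤ 1 / 2) {n x : Fin 3 → ℝ}
    (hn : ∀ i, n i ∈ Set.Icc (1 / 2) 1) {p : Fin 3 → E3} (hp : ∀ i, ‖p i‖ = a * x i)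
    (hb : n 0 ^ 3 • p 0 + n 1 ^ 3 • p 1 + n 2 ^ 3 • p 2 = 0)
    (h01 : |stationarityDefect n x 0 1 2| ≤ δ) (h02 : |stationarityDefect n x 0 2 1| ≤ δ)
    (h12 : |stationarityDefect n x 1 2 0| ≤ δ) :
    coulombCost p ≤ ENNReal.ofReal (√3 / a * (dualValue n x + 4 * δ ^ 2)) := by
  have hκ := dualScale_pos ha
  have hn0 : ∀ i, 0 < n i := fun i => by linarith [(hn i).1]
  have hs : ∀ i j, 0 < dualScale a * (n i * n j) := fun i j => mul_pos hκ (mul_pos (hn0 i) (hn0 j))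
  have key : ∀ i j k : Fin 3, n i ^ 3 • p i + n j ^ 3 • p j + n k ^ 3 • p k = 0 →
      |stationarityDefect n x i j k| ≤ δ →
      (edist (p i) (p j))⁻¹ ≤ ENNReal.ofReal (3 / 2 * (dualScale a * (n i * n j))
        - 1 / 2 * (dualScale a * (n i * n j)) ^ 3 * dist (p i) (p j) ^ 2
        + dualScale a * (4 * δ ^ 2)) ∧ 0 ≤ 3 / 2 * (dualScale a * (n i * n j))
        - 1 / 2 * (dualScale a * (n i * n j)) ^ 3 * dist (p i) (p j) ^ 2
        + dualScale a * (4 * δ ^ 2) := by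
    intro i j k hb hd
    have e := balanced_dist_sq ha hp hb
    set τ := (dualScale a * (n i * n j) * dist (p i) (p j)) ^ 2 - 1 with hτ
    have hij : 1 / 4 ≤ n i * n j := by nlinarith [(hn i).1, (hn j).1]
    have hij1 : n i * n j ≤ 1 := by nlinarith [(hn i).2, (hn j).2, hn0 i, hn0 j]
    have hτ1 : n i * n j * |τ| ≤ δ / 3 := by
      rw [← abs_of_pos (mul_pos (hn0 i) (hn0 j)), ← abs_mul, e, abs_div,
        abs_of_pos (by norm_num : (0 : ℝ) < 3)]
      linarith
    have hδ0 : 0 ≤ δ := (abs_nonneg _).trans hd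
    have hτ2 : |τ| ≤ 4 / 3 * δ := by nlinarith [abs_nonneg τ]
    have hτ4 : n i * n j * τ ^ 2 ≤ 2 * δ ^ 2 := by
      rw [← sq_abs]; nlinarith [abs_nonneg τ, mul_nonneg hδ0 hδ0]
    -- Since `|τ| ≤ 4 δ / 3 ≤ 2 / 3`, the square `(s d) ^ 2` is at least `1 / 3`.
    have hle := edist_inv_le_ofReal (p i) (p j) (hs i j) (by
      have := (abs_le.1 hτ2).1
      linarith)
    have hle2 : 3 / 2 * (dualScale a * (n i * n j))
        - 1 / 2 * (dualScale a * (n i * n j)) ^ 3 * dist (p i) (p j) ^ 2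
        + 2 * (dualScale a * (n i * n j)) * τ ^ 2 ≤ 3 / 2 * (dualScale a * (n i * n j))
        - 1 / 2 * (dualScale a * (n i * n j)) ^ 3 * dist (p i) (p j) ^ 2
        + dualScale a * (4 * δ ^ 2) := by nlinarith
    have hle3 := hle.trans (ENNReal.ofReal_le_ofReal hle2)
    refine ⟨hle3, ?_⟩
    -- Nonnegativity is needed to add the `ENNReal.ofReal` bounds. A negative bound would be
    -- truncated to 0 and force an infinite distance.
    by_contra hneg
    rw [ENNReal.ofReal_of_nonpos (not_le.1 hneg).le] at hle3
    exact edist_ne_top (p i) (p j) (ENNReal.inv_eq_zero.1 (le_antisymm hle3 zero_le))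
  obtain ⟨a1, a2⟩ := key 0 1 2 hb h01
  obtain ⟨b1, b2⟩ := key 0 2 1 (by rw [← hb]; abel) h02
  obtain ⟨c1, c2⟩ := key 1 2 0 (by rw [← hb]; abel) h12
  have h := sum_tangent_eq ha n x p hp
  rw [coulombCost_three]
  refine (add_le_add (add_le_add a1 b1) c1).trans ?_
  rw [← ENNReal.ofReal_add a2 b2, ← ENNReal.ofReal_add (add_nonneg a2 b2) c2]
  refine ENNReal.ofReal_le_ofReal ?_
  have hκ3 : √3 / a = 3 * dualScale a := by simp only [dualScale]; field_simp
  rw [hb, norm_zero] at h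
  simp only [hκ3] at h ⊢
  linarith

/-! ### Balanced configurations with prescribed radii -/

/-- The planar configuration with radii `r` that is balanced by the weights `w`. -/
noncomputable def balancedConfig (w r : Fin 3 → ℝ) : Fin 3 → E3 :=
  let c := ((w 2 * r 2) ^ 2 - (w 0 * r 0) ^ 2 - (w 1 * r 1) ^ 2) / (2 * (w 0 * r 0) * (w 1 * r 1))
  let p : E3 := !₂[r 0, 0, 0]
  let q : E3 := !₂[r 1 * c, r 1 * √(1 - c ^ 2), 0]
  ![p, q, -(w 0 / w 2) • p - (w 1 / w 2) • q]

theorem balancedConfig_balanced {w : Fin 3 → ℝ} (r : Fin 3 → ℝ) (hw : w 2 ≠ 0) :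
    w 0 • balancedConfig w r 0 + w 1 • balancedConfig w r 1 + w 2 • balancedConfig w r 2 = 0 := by
  simp only [balancedConfig, Matrix.cons_val]
  rw [smul_sub, smul_smul, smul_smul, mul_neg, mul_div_cancel₀ _ hw, mul_div_cancel₀ _ hw, neg_smul]
  abel

/-- The balanced vectors form a closed triangle with sides `w_i r_i`, and `c` is given by the law of
cosines. The triangle inequalities give `|c| ≤ 1`. -/
theorem norm_balancedConfig {w r : Fin 3 → ℝ} (hw : ∀ i, 0 < w i) (hr : ∀ i, 0 < r i)
    (h0 : w 0 * r 0 ≤ w 1 * r 1 + w 2 * r 2) (h1 : w 1 * r 1 ≤ w 0 * r 0 + w 2 * r 2)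
    (h2 : w 2 * r 2 ≤ w 0 * r 0 + w 1 * r 1) (i : Fin 3) : ‖balancedConfig w r i‖ = r i := by
  have l := fun i => mul_pos (hw i) (hr i)
  set c := ((w 2 * r 2) ^ 2 - (w 0 * r 0) ^ 2 - (w 1 * r 1) ^ 2) / (2 * (w 0 * r 0) * (w 1 * r 1))
    with hc
  have hcm : c * (2 * (w 0 * r 0) * (w 1 * r 1))
      = (w 2 * r 2) ^ 2 - (w 0 * r 0) ^ 2 - (w 1 * r 1) ^ 2 :=
    div_mul_cancel₀ _ (by have := l 0; have := l 1; positivity)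
  have hc1 : c ≤ 1 := by
    rw [hc, div_le_one (by have := l 0; have := l 1; positivity)]
    nlinarith [l 0, l 1, l 2]
  have hc2 : -1 ≤ c := by
    rw [hc, le_div_iff₀ (by have := l 0; have := l 1; positivity)]
    nlinarith [l 0, l 1, l 2, mul_nonneg (sub_nonneg.2 h0) (sub_nonneg.2 h1)]
  have hs : √(1 - c ^ 2) ^ 2 = 1 - c ^ 2 := Real.sq_sqrt (by nlinarith)
  have hb : balancedConfig w r = ![!₂[r 0, 0, 0], !₂[r 1 * c, r 1 * √(1 - c ^ 2), 0],
    -(w 0 / w 2) • !₂[r 0, 0, 0] - (w 1 / w 2) • !₂[r 1 * c, r 1 * √(1 - c ^ 2), 0]] := rfl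
  refine (sq_eq_sq₀ (norm_nonneg _) (hr i).le).1 ?_
  rw [EuclideanSpace.norm_sq_eq, Fin.sum_univ_three, hb]
  simp only [Real.norm_eq_abs, sq_abs]
  clear_value c
  have hw2 := (hw 2).ne'
  fin_cases i
  · simp
  · simp only [Fin.mk_one, Matrix.cons_val]
    linear_combination (r 1) ^ 2 * hs
  · simp only [Fin.reduceFinMk, Matrix.cons_val, PiLp.sub_apply, PiLp.smul_apply, smul_eq_mul]
    have e : (-(w 0 / w 2) * r 0 - w 1 / w 2 * (r 1 * c)) ^ 2
        + (-(w 0 / w 2) * 0 - w 1 / w 2 * (r 1 * √(1 - c ^ 2))) ^ 2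
        + (-(w 0 / w 2) * 0 - w 1 / w 2 * 0) ^ 2
        = ((w 0 * r 0 + w 1 * r 1 * c) ^ 2 + (w 1 * r 1) ^ 2 * √(1 - c ^ 2) ^ 2) / w 2 ^ 2 := by
      field_simp; ring
    rw [e, hs, div_eq_iff (pow_ne_zero 2 hw2)]
    linear_combination hcm

/-- The nearly optimal configuration of three electrons with shell coordinates `u`. -/
noncomputable def shellConfig (a ε : ℝ) (u : Fin 3 → ℝ) : Fin 3 → E3 :=
  balancedConfig (fun i => shellWeight ε u i ^ 3) (fun i => a * shellRadius ε u i)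

theorem measurable_shellConfig (a ε : ℝ) : Measurable (shellConfig a ε) := by
  refine measurable_pi_lambda _ fun i => ?_
  have h : ∀ f g h : (Fin 3 → ℝ) → ℝ, Measurable f → Measurable g → Measurable h →
      Measurable fun u => (!₂[f u, g u, h u] : E3) := fun f g h hf hg hh => by
    refine (WithLp.measurable_toLp 2 (Fin 3 → ℝ)).comp (measurable_pi_lambda _ fun j => ?_)
    fin_cases j
    · exact hf
    · exact hg
    · exact hh
  have hp : Measurable fun u => shellConfig a ε u 0 := by
    simp only [shellConfig, balancedConfig, Matrix.cons_val, shellWeight, shellRadius]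
    refine h _ _ _ ?_ ?_ ?_ <;> fun_prop
  have hq : Measurable fun u => shellConfig a ε u 1 := by
    simp only [shellConfig, balancedConfig, Matrix.cons_val, shellWeight, shellRadius]
    refine h _ _ _ ?_ ?_ ?_ <;> fun_prop
  fin_cases i
  · exact hp
  · exact hq
  · change Measurable fun u => -(shellWeight ε u 0 ^ 3 / shellWeight ε u 2 ^ 3) • shellConfig a ε u 0
      - (shellWeight ε u 1 ^ 3 / shellWeight ε u 2 ^ 3) • shellConfig a ε u 1
    have hc : ∀ k l, Measurable fun u => shellWeight ε u k ^ 3 / shellWeight ε u l ^ 3 := by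
      intro k l
      simp only [shellWeight]
      fun_prop
    exact ((hc 0 2).neg.smul hp).sub ((hc 1 2).smul hq)

theorem norm_shellConfig {a ε : ℝ} (ha : 0 < a) (hε : ε ∈ Set.Icc (0 : ℝ) (1 / 10))
    {u : Fin 3 → ℝ} (hu : u ∈ Set.Icc (0 : Fin 3 → ℝ) 1) (i : Fin 3) :
    ‖shellConfig a ε u i‖ = a * shellRadius ε u i := by
  have hn := shellWeight_mem ⟨hε.1, hε.2.trans (by norm_num)⟩ hu
  have hx := shellRadius_mem hε.1 hu
  -- For `ε ≤ 1 / 10` all sides `w_i r_i` lie in `[17/20 * a, 11/10 * a]`, so any two together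
  -- exceed the third.
  have hn' : ∀ i, 17 / 20 ≤ shellWeight ε u i ^ 3 ∧ shellWeight ε u i ^ 3 ≤ 1 := fun i => by
    have h1 : 19 / 20 ≤ shellWeight ε u i := by linarith [(hn i).1, hε.2]
    have h2 := pow_le_pow_left₀ (by norm_num) h1 3
    exact ⟨by linarith, pow_le_one₀ (by linarith) (hn i).2⟩
  have hl : ∀ i, 17 / 20 * a ≤ shellWeight ε u i ^ 3 * (a * shellRadius ε u i) ∧
      shellWeight ε u i ^ 3 * (a * shellRadius ε u i) ≤ 11 / 10 * a := fun i => by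
    have h1 : a ≤ a * shellRadius ε u i := le_mul_of_one_le_right ha.le (hx i).1
    have h2 : a * shellRadius ε u i ≤ a * (11 / 10) :=
      mul_le_mul_of_nonneg_left (by linarith [(hx i).2, hε.2]) ha.le
    constructor <;> nlinarith [(hn' i).1, (hn' i).2]
  refine norm_balancedConfig (fun i => by linarith [(hn' i).1])
    (fun i => mul_pos ha (by linarith [(hx i).1])) ?_ ?_ ?_ i <;>
    linarith [hl 0, hl 1, hl 2]

theorem shell_cost_bounds :
    ∃ K ε₁ : ℝ, 0 ≤ K ∧ 0 < ε₁ ∧ ε₁ ≤ 1 / 10 ∧ ∀ a ε : ℝ, 0 < a → 0 < ε → ε < ε₁ →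
      ∀ u ∈ Set.Icc (0 : Fin 3 → ℝ) 1,
        coulombCost (shellConfig a ε u) ≤ ENNReal.ofReal (√3 / a * (shellQuad ε u + K * ε ^ 3)) ∧
        ∀ p : Fin 3 → E3, (∀ i, ‖p i‖ = a * shellRadius ε u i) →
          ENNReal.ofReal (√3 / a * (shellQuad ε u - K * ε ^ 3)) ≤ coulombCost p := by
  obtain ⟨K, hK, hP⟩ := dualValue_shell_bound
  obtain ⟨A, hA, h01⟩ := stationarityDefect_shell_bound 0 1 2 (fun u => by ring)
  obtain ⟨B, hB, h02⟩ := stationarityDefect_shell_bound 0 2 1 (fun u => by ring)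
  obtain ⟨D, hD, h12⟩ := stationarityDefect_shell_bound 1 2 0 (fun u => by ring)
  set M := A + B + D with hM
  -- This threshold gives both `ε ≤ 1 / 10` and `M ε ≤ 1 / 10`; the latter keeps the defect bound `M
  -- ε ^ 2` below `1 / 2`.
  refine ⟨K + 4 * M ^ 2, 1 / (10 * (1 + M)), by positivity, by positivity, ?_, ?_⟩
  · rw [div_le_div_iff₀ (by positivity) (by norm_num)]; linarith
  intro a ε ha hε hε1 u hu
  have hM0 : 0 ≤ M := by positivity
  rw [lt_div_iff₀ (by positivity)] at hε1
  have hε10 : ε ≤ 1 / 10 := by nlinarith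
  have hεI : ε ∈ Set.Icc (0 : ℝ) 1 := ⟨hε.le, by linarith⟩
  have hn := shellWeight_mem hεI hu
  have hs : (0 : ℝ) < √3 / a := by positivity
  have hPu := abs_le.1 (hP ε hεI u hu)
  constructor
  · have hb : shellWeight ε u 0 ^ 3 • shellConfig a ε u 0 + shellWeight ε u 1 ^ 3 • shellConfig a ε u 1
        + shellWeight ε u 2 ^ 3 • shellConfig a ε u 2 = 0 := by
      have : 0 < shellWeight ε u 2 := by linarith [(hn 2).1]
      exact balancedConfig_balanced (w := fun i => shellWeight ε u i ^ 3) _ (pow_pos this 3).ne'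
    have hδ : M * ε ^ 2 ≤ 1 / 2 := by nlinarith [mul_nonneg hM0 hε.le]
    refine (coulombCost_le_dualValue (δ := M * ε ^ 2) ha hδ
      (fun i => ⟨by linarith [(hn i).1], (hn i).2⟩)
      (norm_shellConfig ha ⟨hε.le, hε10⟩ hu) hb
      ((h01 ε hεI u hu).trans ?_) ((h02 ε hεI u hu).trans ?_) ((h12 ε hεI u hu).trans ?_)).trans
      (ENNReal.ofReal_le_ofReal (mul_le_mul_of_nonneg_left ?_ hs.le))
    · exact mul_le_mul_of_nonneg_right (by linarith) (by positivity)
    · exact mul_le_mul_of_nonneg_right (by linarith) (by positivity)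
    · exact mul_le_mul_of_nonneg_right (by linarith) (by positivity)
    -- The error of the configuration is of order `ε ^ 4` and is absorbed into the cubic one.
    · have h1 : ε ^ 4 ≤ ε ^ 3 := pow_le_pow_of_le_one hε.le hεI.2 (by norm_num)
      have h2 := mul_le_mul_of_nonneg_left h1 (by positivity : 0 ≤ 4 * M ^ 2)
      have h3 : 4 * (M * ε ^ 2) ^ 2 = 4 * M ^ 2 * ε ^ 4 := by ring
      linarith [hPu.2]
  · intro p hp
    refine (ENNReal.ofReal_le_ofReal (mul_le_mul_of_nonneg_left ?_ hs.le)).trans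
      (dualValue_le_coulombCost ha (n := shellWeight ε u) (fun i => by linarith [(hn i).1]) hp)
    have : 0 ≤ 4 * M ^ 2 * ε ^ 3 := by positivity
    linarith [hPu.1]

/-! ### Radial integration and the shell coordinate -/

theorem lintegral_fun_norm_three {f : ℝ → ℝ≥0∞} (hf : Measurable f) :
    ∫⁻ x : E3, f ‖x‖ = ∫⁻ r in Set.Ioi (0 : ℝ), ENNReal.ofReal (4 * Real.pi * r ^ 2) * f r := by
  have hfin : Module.finrank ℝ E3 = 3 := by simp
  have hsph : (volume : Measure E3).toSphere Set.univ = ENNReal.ofReal (4 * Real.pi) := by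
    rw [Measure.toSphere_apply_univ, hfin, EuclideanSpace.volume_ball_fin_three]
    rw [show ((3 : ℕ) : ℝ≥0∞) = ENNReal.ofReal 3 by simp, ENNReal.ofReal_one, one_pow, one_mul,
      ← ENNReal.ofReal_mul (by norm_num)]
    congr 1; ring
  calc ∫⁻ x : E3, f ‖x‖
      = ∫⁻ x : ({0}ᶜ : Set E3), f ‖x.1‖ ∂((volume : Measure E3).comap (↑)) := by
        rw [lintegral_subtype_comap (measurableSet_singleton _).compl fun x : E3 ↦ f ‖x‖,
          restrict_compl_singleton]
    _ = ∫⁻ x, f x.2 ∂((volume : Measure E3).toSphere.prod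
          (.volumeIoiPow (Module.finrank ℝ E3 - 1))) := by
        simpa using (volume : Measure E3).measurePreserving_homeomorphUnitSphereProd.lintegral_comp
          (f := fun x => f x.2) (by fun_prop)
    _ = (volume : Measure E3).toSphere Set.univ
          * ∫⁻ x : Set.Ioi (0 : ℝ), f x ∂(.volumeIoiPow (Module.finrank ℝ E3 - 1)) := by
        rw [lintegral_prod _ (by fun_prop)]
        simp [mul_comm]
    _ = _ := by
        rw [hsph, Measure.volumeIoiPow, lintegral_withDensity_eq_lintegral_mul _ (by fun_prop)
          (by fun_prop), hfin]
        have := lintegral_subtype_comap (μ := volume) (measurableSet_Ioi (a := (0 : ℝ)))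
          fun r => ENNReal.ofReal (r ^ 2) * f r
        simp only [Pi.mul_apply]
        rw [this, ← lintegral_const_mul _ (by fun_prop)]
        refine lintegral_congr fun r => ?_
        rw [ENNReal.ofReal_mul (p := 4 * Real.pi) (by positivity), mul_assoc]

/-- No measurability of `g` is required, so the change of variables can be used for `reducedCost`
directly. -/
theorem lintegral_comp_affine {α : ℝ} (hα : α ≠ 0) (β : ℝ) {s : Set ℝ} (hs : MeasurableSet s)
    (g : ℝ → ℝ≥0∞) :
    ∫⁻ x in (fun u => α * u + β) '' s, g x
      = ENNReal.ofReal |α| * ∫⁻ u in s, g (α * u + β) := by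
  rw [lintegral_image_eq_lintegral_abs_deriv_mul hs (f' := fun _ => α)
    (fun x _ => by simpa using (((hasDerivAt_id x).const_mul α).add_const β).hasDerivWithinAt)
    (fun x _ y _ h => by simpa [hα] using h)]
  exact lintegral_const_mul' _ _ ENNReal.ofReal_ne_top

theorem image_affine_Icc_of_pos {α : ℝ} (hα : 0 < α) (β c d : ℝ) :
    (fun u => α * u + β) '' Set.Icc c d = Set.Icc (α * c + β) (α * d + β) := by
  ext y
  simp only [Set.mem_image, Set.mem_Icc]
  constructor
  · rintro ⟨x, ⟨h1, h2⟩, rfl⟩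
    constructor <;> nlinarith
  · rintro ⟨h1, h2⟩
    refine ⟨(y - β) / α, ⟨?_, ?_⟩, by field_simp; ring⟩
    · rw [le_div_iff₀ hα]; linarith
    · rw [div_le_iff₀ hα]; linarith

theorem image_affine_Icc_of_neg {α : ℝ} (hα : α < 0) (β c d : ℝ) :
    (fun u => α * u + β) '' Set.Icc c d = Set.Icc (α * d + β) (α * c + β) := by
  ext y
  simp only [Set.mem_image, Set.mem_Icc]
  constructor
  · rintro ⟨x, ⟨h1, h2⟩, rfl⟩
    constructor <;> nlinarith
  · rintro ⟨h1, h2⟩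
    refine ⟨(y - β) / α, ⟨?_, ?_⟩, by rw [mul_div_cancel₀ _ hα.ne]; ring⟩
    · rw [le_div_iff_of_neg hα]; linarith
    · rw [div_le_iff_of_neg hα]; linarith

theorem radial_shellDensity_eq {a ε : ℝ} (ha : 0 < a) (hε : 0 < ε) {r : ℝ}
    (hr : r ∈ Set.Icc a ((1 + ε) * a)) : 4 * Real.pi * r ^ 2 * shellDensity a ε r = 3 / (a * ε) := by
  have : 0 < r := ha.trans_le hr.1
  rw [shellDensity, if_pos (Set.mem_Icc.1 hr)]
  field_simp

theorem shellDensity_eq_zero {a ε r : ℝ} (hr : r ∉ Set.Icc a ((1 + ε) * a)) :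
    shellDensity a ε r = 0 := if_neg hr

theorem shellDensity_ne_zero_iff {a ε : ℝ} (ha : 0 < a) (hε : 0 < ε) {r : ℝ} :
    shellDensity a ε r ≠ 0 ↔ r ∈ Set.Icc a ((1 + ε) * a) := by
  refine ⟨fun h => by_contra fun hr => h (shellDensity_eq_zero hr), fun hr h => ?_⟩
  have := radial_shellDensity_eq ha hε hr
  rw [h, mul_zero] at this
  exact (by positivity : 3 / (a * ε) ≠ 0) this.symm

theorem measurable_shellDensity (a ε : ℝ) : Measurable (shellDensity a ε) := by
  unfold shellDensity
  exact Measurable.ite (measurableSet_Icc (a := a) (b := (1 + ε) * a)) (by fun_prop) (by fun_prop)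

/-- In a thin shell, the radial integral against the single-particle law is an average over the
uniformly distributed shell coordinate. -/
theorem lintegral_radial_shell {a ε : ℝ} (ha : 0 < a) (hε : 0 < ε) (g : ℝ → ℝ≥0∞) :
    ∫⁻ r in Set.Ioi (0 : ℝ), ENNReal.ofReal (4 * Real.pi * r ^ 2 * (shellDensity a ε r / 3)) * g r
      = ∫⁻ u in Set.Icc (0 : ℝ) 1, g (a * (1 + u * ε)) := by
  have h1 : ∀ r, ENNReal.ofReal (4 * Real.pi * r ^ 2 * (shellDensity a ε r / 3)) * g r
      = (Set.Icc a ((1 + ε) * a)).indicator (fun r => ENNReal.ofReal (1 / (a * ε)) * g r) r := by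
    intro r
    by_cases hr : r ∈ Set.Icc a ((1 + ε) * a)
    · rw [Set.indicator_of_mem hr, ← mul_div_assoc, radial_shellDensity_eq ha hε hr]
      congr 2; field_simp
    · rw [Set.indicator_of_notMem hr, shellDensity_eq_zero hr]; simp
  have hsub : Set.Icc a ((1 + ε) * a) ⊆ Set.Ioi 0 := fun r hr => ha.trans_le hr.1
  have haε : 0 < a * ε := mul_pos ha hε
  have him := image_affine_Icc_of_pos haε a 0 1
  rw [mul_zero, zero_add, mul_one, show a * ε + a = (1 + ε) * a by ring] at him
  simp_rw [h1]
  rw [setLIntegral_indicator measurableSet_Icc, Set.inter_eq_left.2 hsub, ← him,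
    lintegral_comp_affine haε.ne' _ measurableSet_Icc, abs_of_pos haε,
    lintegral_const_mul' _ _ ENNReal.ofReal_ne_top, ← mul_assoc, ← ENNReal.ofReal_mul haε.le,
    mul_one_div_cancel haε.ne', ENNReal.ofReal_one, one_mul]
  refine lintegral_congr fun u => ?_
  congr 1; ring

theorem lintegral_norm_shell {a ε : ℝ} (ha : 0 < a) (hε : 0 < ε) {g : ℝ → ℝ≥0∞}
    (hg : Measurable g) :
    ∫⁻ x : E3, ENNReal.ofReal (shellDensity a ε ‖x‖ / 3) * g ‖x‖
      = ∫⁻ u in Set.Icc (0 : ℝ) 1, g (a * (1 + u * ε)) := by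
  have hm := measurable_shellDensity a ε
  rw [lintegral_fun_norm_three (f := fun r => ENNReal.ofReal (shellDensity a ε r / 3) * g r)
    (by fun_prop), ← lintegral_radial_shell ha hε]
  refine lintegral_congr fun r => ?_
  rw [← mul_assoc, ← ENNReal.ofReal_mul (by positivity)]

theorem singleParticleLaw_three (ρ : ℝ → ℝ) :
    singleParticleLaw 3 ρ
      = (volume : Measure E3).withDensity (fun x => ENNReal.ofReal (ρ ‖x‖ / 3)) := by
  rw [singleParticleLaw, ← withDensity_smul' _ _ (by simp)]
  congr 1
  ext x
  rw [Pi.smul_apply, smul_eq_mul, div_eq_inv_mul, ENNReal.ofReal_mul (by positivity),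
    ENNReal.ofReal_inv_of_pos (by norm_num)]
  simp

theorem lintegral_norm_singleParticleLaw {a ε : ℝ} (ha : 0 < a) (hε : 0 < ε) {g : ℝ → ℝ≥0∞}
    (hg : Measurable g) :
    ∫⁻ x, g ‖x‖ ∂(singleParticleLaw 3 (shellDensity a ε))
      = ∫⁻ u in Set.Icc (0 : ℝ) 1, g (a * (1 + u * ε)) := by
  have hm := measurable_shellDensity a ε
  rw [← lintegral_norm_shell ha hε hg, singleParticleLaw_three,
    lintegral_withDensity_eq_lintegral_mul _ (by fun_prop) (by fun_prop)]
  rfl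

/-! ### Averaging over the orthogonal group -/

/-- The orthogonal group of `ℝ³`. -/
abbrev Rotation : Type := unitary (E3 →L[ℝ] E3)

instance : ContinuousStar (E3 →L[ℝ] E3) :=
  ⟨(ContinuousLinearMap.adjoint : (E3 →L[ℝ] E3) ≃ₗᵢ⋆[ℝ] (E3 →L[ℝ] E3)).continuous⟩

instance : CompactSpace Rotation := by
  refine isCompact_iff_compactSpace.1 (?_ : IsCompact (unitary (E3 →L[ℝ] E3) : Set (E3 →L[ℝ] E3)))
  refine (isCompact_closedBall (0 : E3 →L[ℝ] E3) 1).of_isClosed_subset isClosed_unitary ?_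
  intro g hg
  rw [mem_closedBall_zero_iff]
  exact ContinuousLinearMap.opNorm_le_bound _ zero_le_one fun x => by
    rw [one_mul]; exact (Unitary.norm_map ⟨g, hg⟩ x).le

/-- The uniform distribution on the orthogonal group. -/
noncomputable def rotationLaw : Measure Rotation := Measure.haarMeasure ⊤

instance : IsProbabilityMeasure rotationLaw :=
  ⟨by simpa [rotationLaw] using
    Measure.haarMeasure_self (K₀ := (⊤ : TopologicalSpace.PositiveCompacts Rotation))⟩

instance : rotationLaw.IsMulLeftInvariant := by unfold rotationLaw; infer_instance

/-- The inverse of the rotation `g`, applied to `v`. -/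
noncomputable def rotate (g : Rotation) (v : E3) : E3 := ((g⁻¹ : Rotation) : E3 →L[ℝ] E3) v

theorem norm_rotate (g : Rotation) (v : E3) : ‖rotate g v‖ = ‖v‖ := Unitary.norm_map g⁻¹ v

theorem edist_rotate (g : Rotation) (v w : E3) : edist (rotate g v) (rotate g w) = edist v w := by
  rw [edist_dist, edist_dist, dist_eq_norm, dist_eq_norm, ← norm_rotate g (v - w), rotate, rotate,
    rotate, map_sub]

theorem measurable_rotate : Measurable fun z : Rotation × E3 => rotate z.1 z.2 := by
  have : Continuous fun z : Rotation × E3 => rotate z.1 z.2 :=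
    (continuous_subtype_val.comp (continuous_fst.inv)).clm_apply continuous_snd
  exact this.measurable

theorem Measurable.rotate {α : Type*} [MeasurableSpace α] {A : α → Rotation}
    {v : α → E3} (hA : Measurable A) (hv : Measurable v) :
    Measurable fun x => rotate (A x) (v x) := by
  have h : Measurable fun x => (A x, v x) := hA.prodMk hv
  have := Measurable.comp measurable_rotate h
  exact this

/-- A reflection `k` carries `v` to `w`. As `rotate` acts by the inverse, left translation of `g` by
`k⁻¹` replaces `v` by `k v`, so left invariance of the Haar measure is what is needed. -/
theorem lintegral_rotation_congr (f : E3 → ℝ≥0∞) {v w : E3} (h : ‖v‖ = ‖w‖) :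
    ∫⁻ g, f (rotate g v) ∂rotationLaw
      = ∫⁻ g, f (rotate g w) ∂rotationLaw := by
  set e : E3 ≃ₗᵢ[ℝ] E3 := (ℝ ∙ (v - w))ᗮ.reflection
  set k : Rotation := Unitary.linearIsometryEquiv.symm e
  have hk : (k : E3 →L[ℝ] E3) v = w := Submodule.reflection_sub h
  rw [← lintegral_mul_left_eq_self _ k⁻¹]
  refine lintegral_congr fun g => ?_
  rw [rotate, mul_inv_rev, inv_inv, ← hk]
  rfl

/-- The average of `f` over the sphere of radius `r`. -/
noncomputable def sphereAverage (f : E3 → ℝ≥0∞) (r : ℝ) : ℝ≥0∞ :=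
  ∫⁻ g, f (rotate g (r • EuclideanSpace.single 0 1)) ∂rotationLaw

theorem lintegral_rotation_eq_sphereAverage (f : E3 → ℝ≥0∞) (v : E3) :
    ∫⁻ g, f (rotate g v) ∂rotationLaw = sphereAverage f ‖v‖ :=
  lintegral_rotation_congr f (by simp [norm_smul])

theorem measurable_sphereAverage {f : E3 → ℝ≥0∞} (hf : Measurable f) :
    Measurable (sphereAverage f) := by
  unfold sphereAverage
  refine Measurable.lintegral_prod_right' (ν := rotationLaw)
    (f := fun z : ℝ × Rotation => f (rotate z.2
      (z.1 • EuclideanSpace.single 0 1))) ?_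
  exact hf.comp (measurable_snd.rotate (measurable_fst.smul_const _))

/-- The law is invariant under each rotation; averaging over rotations and exchanging the integrals
gives the claim. -/
theorem lintegral_singleParticleLaw_eq_sphereAverage {ρ : ℝ → ℝ} (hρ : Measurable ρ)
    {f : E3 → ℝ≥0∞} (hf : Measurable f) :
    ∫⁻ x, f x ∂(singleParticleLaw 3 ρ)
      = ∫⁻ x, sphereAverage f ‖x‖ ∂(singleParticleLaw 3 ρ) := by
  have hd : Measurable fun x : E3 => ENNReal.ofReal (ρ ‖x‖ / 3) := by fun_prop
  have hinv : ∀ g : Rotation, ∫⁻ x, f (rotate g x) ∂(singleParticleLaw 3 ρ)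
      = ∫⁻ x, f x ∂(singleParticleLaw 3 ρ) := fun g => by
    have hg : Measurable fun x => f (rotate g x) :=
      hf.comp (measurable_const.rotate measurable_id)
    rw [singleParticleLaw_three, lintegral_withDensity_eq_lintegral_mul _ hd hg,
      lintegral_withDensity_eq_lintegral_mul _ hd hf]
    have := (Unitary.linearIsometryEquiv g⁻¹).measurePreserving.lintegral_comp (hd.mul hf)
    rw [← this]
    refine lintegral_congr fun x => ?_
    simp only [Pi.mul_apply, LinearIsometryEquiv.norm_map]
    rfl
  have : SFinite (singleParticleLaw 3 ρ) := by rw [singleParticleLaw_three]; infer_instance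
  simp_rw [← lintegral_rotation_eq_sphereAverage]
  rw [lintegral_lintegral_swap]
  · simp [hinv]
  · exact (hf.comp (measurable_snd.rotate measurable_fst)).aemeasurable

/-- After a random rotation only the law of the radius matters, and `hT` says that the shell
coordinate `T` is uniform. -/
theorem map_rotation_eq_singleParticleLaw {a ε : ℝ} (ha : 0 < a) (hε : 0 < ε) {P : ℝ → E3}
    (hP : Measurable P) {T : ℝ → ℝ}
    (hPT : ∀ u ∈ Set.Icc (0 : ℝ) 1, ‖P u‖ = a * (1 + T u * ε))
    (hT : ∀ g : ℝ → ℝ≥0∞, ∫⁻ u in Set.Icc (0 : ℝ) 1, g (T u) = ∫⁻ u in Set.Icc (0 : ℝ) 1, g u) :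
    (rotationLaw.prod (volume.restrict (Set.Icc (0 : ℝ) 1))).map
        (fun z => rotate z.1 (P z.2))
      = singleParticleLaw 3 (shellDensity a ε) := by
  have hm : Measurable fun z : Rotation × ℝ => rotate z.1 (P z.2) :=
    measurable_fst.rotate (hP.comp measurable_snd)
  refine Measure.ext_of_lintegral _ fun f hf => ?_
  rw [lintegral_map hf hm,
    lintegral_prod_symm (fun z => f (rotate z.1 (P z.2))) (hf.comp hm).aemeasurable,
    lintegral_singleParticleLaw_eq_sphereAverage (measurable_shellDensity a ε) hf,
    lintegral_norm_singleParticleLaw ha hε (measurable_sphereAverage hf),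
    ← hT fun u => sphereAverage f (a * (1 + u * ε))]
  refine setLIntegral_congr_fun measurableSet_Icc fun u hu => ?_
  simp only
  rw [lintegral_rotation_eq_sphereAverage, hPT u hu]

/-! ### Uniform variables with constant sum -/

/-- Three functions of a uniform variable on `[0, 1]` that are uniform on `[0, 1]` and have
constant sum. -/
noncomputable def uniformTriple (u : ℝ) : Fin 3 → ℝ :=
  ![u, if u ≤ 1 / 2 then u + 1 / 2 else u - 1 / 2, if u ≤ 1 / 2 then 1 - 2 * u else 2 - 2 * u]

theorem uniformTriple_sum (u : ℝ) :
    uniformTriple u 0 + uniformTriple u 1 + uniformTriple u 2 = 3 / 2 := by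
  simp only [uniformTriple, Matrix.cons_val]
  split_ifs <;> ring

theorem uniformTriple_mem {u : ℝ} (hu : u ∈ Set.Icc (0 : ℝ) 1) :
    uniformTriple u ∈ Set.Icc (0 : Fin 3 → ℝ) 1 := by
  obtain ⟨h0, h1⟩ := hu
  constructor <;> intro i <;> fin_cases i <;>
    simp only [uniformTriple, Fin.mk_one, Fin.zero_eta, Fin.reduceFinMk, Matrix.cons_val,
      Pi.zero_apply, Pi.one_apply] <;>
    first | assumption | (split_ifs <;> linarith)

theorem measurable_uniformTriple : Measurable uniformTriple := by
  refine measurable_pi_lambda _ fun i => ?_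
  fin_cases i
  · exact measurable_id
  · exact Measurable.ite measurableSet_Iic (by fun_prop) (by fun_prop)
  · exact Measurable.ite measurableSet_Iic (by fun_prop) (by fun_prop)

theorem setLIntegral_Icc_eq_Ioc (f : ℝ → ℝ≥0∞) (b c : ℝ) :
    ∫⁻ u in Set.Icc b c, f u = ∫⁻ u in Set.Ioc b c, f u :=
  setLIntegral_congr Ioc_ae_eq_Icc.symm

theorem setLIntegral_Icc_add {b c d : ℝ} (hbc : b ≤ c) (hcd : c ≤ d) (f : ℝ → ℝ≥0∞) :
    ∫⁻ u in Set.Icc b d, f u = (∫⁻ u in Set.Icc b c, f u) + ∫⁻ u in Set.Ioc c d, f u := by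
  rw [setLIntegral_Icc_eq_Ioc, setLIntegral_Icc_eq_Ioc, ← Set.Ioc_union_Ioc_eq_Ioc hbc hcd,
    lintegral_union measurableSet_Ioc (Set.Ioc_disjoint_Ioc_of_le le_rfl)]

/-- The second component exchanges the two halves of `[0, 1]`; the third stretches each half onto
the whole interval with slope `-2`, so each half contributes half of the integral. -/
theorem lintegral_uniformTriple (i : Fin 3) (g : ℝ → ℝ≥0∞) :
    ∫⁻ u in Set.Icc (0 : ℝ) 1, g (uniformTriple u i) = ∫⁻ u in Set.Icc (0 : ℝ) 1, g u := by
  have split := setLIntegral_Icc_add (b := 0) (c := 1 / 2) (d := 1) (by norm_num) (by norm_num)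
  have aff : ∀ {α : ℝ} (_ : α ≠ 0) (β c d c' d' : ℝ),
      (fun u => α * u + β) '' Set.Icc c d = Set.Icc c' d' →
      ∫⁻ x in Set.Icc c' d', g x = ENNReal.ofReal |α| * ∫⁻ u in Set.Icc c d, g (α * u + β) := by
    intro α hα β c d c' d' h
    rw [← h, lintegral_comp_affine hα β measurableSet_Icc]
  fin_cases i
  · rfl
  · have e1 : ∫⁻ u in Set.Icc (0 : ℝ) (1 / 2), g (uniformTriple u 1)
        = ∫⁻ u in Set.Icc (1 / 2 : ℝ) 1, g u := by
      rw [aff one_ne_zero (1 / 2) 0 (1 / 2) (1 / 2) 1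
        (by rw [image_affine_Icc_of_pos one_pos]; norm_num), abs_one, ENNReal.ofReal_one, one_mul]
      refine setLIntegral_congr_fun measurableSet_Icc fun u hu => ?_
      simp only [uniformTriple, Matrix.cons_val, if_pos hu.2, one_mul]
    have e2 : ∫⁻ u in Set.Ioc (1 / 2 : ℝ) 1, g (uniformTriple u 1)
        = ∫⁻ u in Set.Icc (0 : ℝ) (1 / 2), g u := by
      rw [aff one_ne_zero (-1 / 2) (1 / 2) 1 0 (1 / 2)
        (by rw [image_affine_Icc_of_pos one_pos]; norm_num), abs_one, ENNReal.ofReal_one, one_mul,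
        setLIntegral_Icc_eq_Ioc]
      refine setLIntegral_congr_fun measurableSet_Ioc fun u hu => ?_
      simp only [uniformTriple, Matrix.cons_val, if_neg (not_le.2 hu.1), one_mul]
      congr 1; ring
    change ∫⁻ u in Set.Icc (0 : ℝ) 1, g (uniformTriple u 1) = _
    rw [split, e1, e2, split g, setLIntegral_Icc_eq_Ioc g (1 / 2), add_comm]
  · have h2 : (-2 : ℝ) < 0 := by norm_num
    have e1 : ∫⁻ u in Set.Icc (0 : ℝ) 1, g u
        = 2 * ∫⁻ u in Set.Icc (0 : ℝ) (1 / 2), g (uniformTriple u 2) := by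
      rw [aff h2.ne 1 0 (1 / 2) 0 1 (by rw [image_affine_Icc_of_neg h2]; norm_num)]
      congr 1
      · norm_num
      refine setLIntegral_congr_fun measurableSet_Icc fun u hu => ?_
      simp only [uniformTriple, Matrix.cons_val, if_pos hu.2]
      congr 1; ring
    have e2 : ∫⁻ u in Set.Icc (0 : ℝ) 1, g u
        = 2 * ∫⁻ u in Set.Ioc (1 / 2 : ℝ) 1, g (uniformTriple u 2) := by
      rw [aff h2.ne 2 (1 / 2) 1 0 1 (by rw [image_affine_Icc_of_neg h2]; norm_num),
        setLIntegral_Icc_eq_Ioc]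
      congr 1
      · norm_num
      refine setLIntegral_congr_fun measurableSet_Ioc fun u hu => ?_
      simp only [uniformTriple, Matrix.cons_val, if_neg (not_le.2 hu.1)]
      congr 1; ring
    change ∫⁻ u in Set.Icc (0 : ℝ) 1, g (uniformTriple u 2) = _
    rw [split]
    have h3 : 2 * ((∫⁻ u in Set.Icc (0 : ℝ) (1 / 2), g (uniformTriple u 2))
        + ∫⁻ u in Set.Ioc (1 / 2 : ℝ) 1, g (uniformTriple u 2))
        = 2 * ∫⁻ u in Set.Icc (0 : ℝ) 1, g u := by
      rw [mul_add, ← e1, ← e2, two_mul]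
    exact (ENNReal.mul_right_inj two_ne_zero ENNReal.ofNat_ne_top).1 h3

theorem setLIntegral_ofReal_Icc {c d : ℝ} (hcd : c ≤ d) {f : ℝ → ℝ} (hf : Continuous f)
    (h0 : ∀ u ∈ Set.Icc c d, 0 ≤ f u) :
    ∫⁻ u in Set.Icc c d, ENNReal.ofReal (f u) = ENNReal.ofReal (∫ u in c..d, f u) := by
  rw [setLIntegral_Icc_eq_Ioc, intervalIntegral.integral_of_le hcd,
    ofReal_integral_eq_lintegral_ofReal]
  · exact (hf.intervalIntegrable c d).1
  · filter_upwards [ae_restrict_mem measurableSet_Ioc] with u hu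
    exact h0 u ⟨hu.1.le, hu.2⟩

/-! ### Symmetrisation and the upper bound for the strong-interaction value -/

theorem measurable_coulombCost_three : Measurable (coulombCost : (Fin 3 → E3) → ℝ≥0∞) := by
  simp only [funext coulombCost_three]
  fun_prop

theorem coulombCost_comp_perm (p : Fin 3 → E3) (σ : Equiv.Perm (Fin 3)) :
    coulombCost (p ∘ σ) = coulombCost p := by
  have h01 : σ 0 ≠ σ 1 := σ.injective.ne (by decide)
  have h02 : σ 0 ≠ σ 2 := σ.injective.ne (by decide)
  have h12 : σ 1 ≠ σ 2 := σ.injective.ne (by decide)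
  rw [coulombCost_three, coulombCost_three]
  simp only [Function.comp]
  generalize σ 0 = i at *
  generalize σ 1 = j at *
  generalize σ 2 = k at *
  have c10 := edist_comm (p 1) (p 0)
  have c20 := edist_comm (p 2) (p 0)
  have c21 := edist_comm (p 2) (p 1)
  fin_cases i <;> fin_cases j <;> fin_cases k <;>
    first
      | exact absurd rfl h01
      | exact absurd rfl h02
      | exact absurd rfl h12
      | (simp only [Fin.zero_eta, Fin.mk_one, Fin.reduceFinMk, c10, c20, c21] <;> ring)

theorem lintegral_average_perm (γ : Measure (Fin 3 → E3)) {f : (Fin 3 → E3) → ℝ≥0∞}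
    (hf : Measurable f) :
    ∫⁻ p, f p ∂((6 : ℝ≥0∞)⁻¹ • ∑ σ : Equiv.Perm (Fin 3), γ.map (fun p => p ∘ σ))
      = 6⁻¹ * ∑ σ : Equiv.Perm (Fin 3), ∫⁻ p, f (p ∘ σ) ∂γ := by
  rw [lintegral_smul_measure, lintegral_finsetSum_measure, smul_eq_mul]
  congr 1
  refine Finset.sum_congr rfl fun σ _ => ?_
  rw [lintegral_map hf (by fun_prop)]

theorem average_perm_const (c : ℝ≥0∞) :
    (6 : ℝ≥0∞)⁻¹ * ∑ _σ : Equiv.Perm (Fin 3), c = c := by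
  rw [Finset.sum_const, Finset.card_univ, Fintype.card_perm, Fintype.card_fin, nsmul_eq_mul,
    ← mul_assoc]
  norm_num [Nat.factorial]
  rw [ENNReal.inv_mul_cancel (by norm_num) (by norm_num), one_mul]

/-- Symmetrising a plan with equal marginals does not change its Coulomb cost. -/
theorem exists_symmetricPlan {ρ : ℝ → ℝ} (γ : Measure (Fin 3 → E3)) [IsProbabilityMeasure γ]
    (hγ : ∀ i, γ.map (fun p => p i) = singleParticleLaw 3 ρ) :
    ∃ γ' ∈ symmetricPlans 3 ρ, ∫⁻ p, coulombCost p ∂γ' = ∫⁻ p, coulombCost p ∂γ := by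
  refine ⟨(6 : ℝ≥0∞)⁻¹ • ∑ σ : Equiv.Perm (Fin 3), γ.map (fun p => p ∘ σ),
    ⟨⟨?_⟩, fun τ => ?_, fun i => ?_⟩, ?_⟩
  · rw [← lintegral_one, lintegral_average_perm γ measurable_const]
    simp only [lintegral_one, measure_univ]
    exact average_perm_const 1
  · refine Measure.ext_of_lintegral _ fun f hf => ?_
    have hfτ : Measurable fun p : Fin 3 → E3 => f (p ∘ τ) := hf.comp (by fun_prop)
    rw [lintegral_map hf (by fun_prop), lintegral_average_perm γ hfτ, lintegral_average_perm γ hf]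
    congr 1
    exact Fintype.sum_equiv (Equiv.mulRight τ) _ _ fun σ => rfl
  · refine Measure.ext_of_lintegral _ fun f hf => ?_
    have hfi : Measurable fun p : Fin 3 → E3 => f (p i) := by fun_prop
    rw [lintegral_map hf (by fun_prop), lintegral_average_perm γ hfi]
    have : ∀ σ : Equiv.Perm (Fin 3), ∫⁻ p, f ((p ∘ σ) i) ∂γ
        = ∫⁻ x, f x ∂(singleParticleLaw 3 ρ) := fun σ => by
      rw [← hγ (σ i), lintegral_map hf (by fun_prop)]
      rfl
    simp only [this]
    exact average_perm_const _
  · rw [lintegral_average_perm γ measurable_coulombCost_three]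
    simp only [coulombCost_comp_perm]
    exact average_perm_const _

instance : IsProbabilityMeasure ((volume : Measure ℝ).restrict (Set.Icc (0 : ℝ) 1)) := ⟨by simp⟩

/-- The configuration obtained by rotating the shell configuration of the uniform triple. -/
noncomputable def rotatedConfig (a ε : ℝ) (z : Rotation × ℝ) (i : Fin 3) : E3 :=
  rotate z.1 (shellConfig a ε (uniformTriple z.2) i)

theorem measurable_shellConfig_uniformTriple (a ε : ℝ) :
    Measurable fun u => shellConfig a ε (uniformTriple u) :=
  (measurable_shellConfig a ε).comp measurable_uniformTriple

theorem measurable_rotatedConfig (a ε : ℝ) : Measurable (rotatedConfig a ε) := by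
  refine measurable_pi_lambda _ fun i => ?_
  have h : Measurable fun z : Rotation × ℝ => shellConfig a ε (uniformTriple z.2) i :=
    (measurable_pi_apply i).comp
      ((measurable_shellConfig_uniformTriple a ε).comp measurable_snd)
  have := Measurable.rotate measurable_fst h
  exact this

theorem coulombCost_rotatedConfig (a ε : ℝ) (z : Rotation × ℝ) :
    coulombCost (rotatedConfig a ε z) = coulombCost (shellConfig a ε (uniformTriple z.2)) := by
  simp only [coulombCost, rotatedConfig, edist_rotate]

/-- The law of the randomly rotated shell configuration of the uniform triple. -/
noncomputable def shellPlan (a ε : ℝ) : Measure (Fin 3 → E3) :=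
  (rotationLaw.prod (volume.restrict (Set.Icc (0 : ℝ) 1))).map (rotatedConfig a ε)

instance (a ε : ℝ) : IsProbabilityMeasure (shellPlan a ε) :=
  Measure.isProbabilityMeasure_map (measurable_rotatedConfig a ε).aemeasurable

theorem map_shellPlan {a ε : ℝ} (ha : 0 < a) (hε : 0 < ε) (hε1 : ε ≤ 1 / 10) (i : Fin 3) :
    (shellPlan a ε).map (fun p => p i) = singleParticleLaw 3 (shellDensity a ε) := by
  have hP : Measurable fun u => shellConfig a ε (uniformTriple u) i :=
    (measurable_pi_apply i).comp (measurable_shellConfig_uniformTriple a ε)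
  have h := map_rotation_eq_singleParticleLaw ha hε hP (T := fun u => uniformTriple u i)
    (fun u hu => norm_shellConfig ha ⟨hε.le, hε1⟩ (uniformTriple_mem hu) i)
    (lintegral_uniformTriple i)
  rw [shellPlan, Measure.map_map (measurable_pi_apply i) (measurable_rotatedConfig a ε), ← h]
  rfl

theorem lintegral_coulombCost_shellPlan (a ε : ℝ) :
    ∫⁻ p, coulombCost p ∂(shellPlan a ε)
      = ∫⁻ u in Set.Icc (0 : ℝ) 1, coulombCost (shellConfig a ε (uniformTriple u)) := by
  have hmc : Measurable fun u => coulombCost (shellConfig a ε (uniformTriple u)) :=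
    measurable_coulombCost_three.comp (measurable_shellConfig_uniformTriple a ε)
  have hmc' : Measurable fun z : Rotation × ℝ => coulombCost (shellConfig a ε (uniformTriple z.2)) :=
    hmc.comp measurable_snd
  rw [shellPlan, lintegral_map measurable_coulombCost_three (measurable_rotatedConfig a ε)]
  simp_rw [coulombCost_rotatedConfig]
  rw [lintegral_prod_symm _ hmc'.aemeasurable]
  simp only [lintegral_const, measure_univ, mul_one]

theorem VSIL_shell_le {a ε K : ℝ} (ha : 0 < a) (hε : 0 < ε) (hε1 : ε ≤ 1 / 10) (hK : 0 ≤ K)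
    (hcost : ∀ u ∈ Set.Icc (0 : Fin 3 → ℝ) 1,
      coulombCost (shellConfig a ε u) ≤ ENNReal.ofReal (√3 / a * (shellQuad ε u + K * ε ^ 3))) :
    VSIL 3 (shellDensity a ε)
      ≤ ENNReal.ofReal (√3 / a * (1 - ε / 2 + 31 / 120 * ε ^ 2 + K * ε ^ 3)) := by
  obtain ⟨γ', hγ', hc⟩ := exists_symmetricPlan (shellPlan a ε) (map_shellPlan ha hε hε1)
  refine (iInf₂_le γ' hγ').trans ?_
  rw [hc, lintegral_coulombCost_shellPlan]
  -- With the sum fixed at `3 / 2` the cost bound splits as `χ (u 0) + χ (u 1) + χ (u 2)`, so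
  -- uniformity of each component suffices to integrate it.
  set χ : ℝ → ℝ := fun v => √3 / a * (1 / 3 - ε / 6 + ε ^ 2 * (v ^ 2 / 30 + 3 / 40) + K * ε ^ 3 / 3)
    with hχ
  have hχ0 : ∀ v, 0 ≤ χ v := fun v => by
    have : 0 ≤ 1 / 3 - ε / 6 := by linarith
    positivity
  have hχc : Continuous χ := by fun_prop
  calc ∫⁻ u in Set.Icc (0 : ℝ) 1, coulombCost (shellConfig a ε (uniformTriple u))
      ≤ ∫⁻ u in Set.Icc (0 : ℝ) 1, (ENNReal.ofReal (χ (uniformTriple u 0))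
          + ENNReal.ofReal (χ (uniformTriple u 1)) + ENNReal.ofReal (χ (uniformTriple u 2))) := by
        refine setLIntegral_mono' measurableSet_Icc fun u hu => ?_
        refine (hcost _ (uniformTriple_mem hu)).trans_eq ?_
        rw [← ENNReal.ofReal_add (hχ0 _) (hχ0 _),
          ← ENNReal.ofReal_add (add_nonneg (hχ0 _) (hχ0 _)) (hχ0 _)]
        congr 1
        simp only [shellQuad, uniformTriple_sum, hχ]
        ring
    _ = 3 * ENNReal.ofReal (∫ v in (0 : ℝ)..1, χ v) := by
        have hm : ∀ i, Measurable fun u => ENNReal.ofReal (χ (uniformTriple u i)) := fun i =>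
          (hχc.measurable.comp ((measurable_pi_apply i).comp measurable_uniformTriple)).ennreal_ofReal
        rw [lintegral_add_right _ (hm 2), lintegral_add_right _ (hm 1),
          lintegral_uniformTriple 0 (fun v => ENNReal.ofReal (χ v)),
          lintegral_uniformTriple 1 (fun v => ENNReal.ofReal (χ v)),
          lintegral_uniformTriple 2 (fun v => ENNReal.ofReal (χ v)),
          setLIntegral_ofReal_Icc zero_le_one hχc fun v _ => hχ0 v]
        ring
    _ ≤ _ := by
        rw [show (3 : ℝ≥0∞) = ENNReal.ofReal 3 by simp, ← ENNReal.ofReal_mul (by norm_num)]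
        refine ENNReal.ofReal_le_ofReal (le_of_eq ?_)
        have : ∫ v in (0 : ℝ)..1, χ v
            = √3 / a * (1 / 3 - ε / 6 + ε ^ 2 * (1 / 90 + 3 / 40) + K * ε ^ 3 / 3) := by
          have e : ∀ v, χ v = √3 / a * (1 / 3 - ε / 6 + ε ^ 2 * (3 / 40) + K * ε ^ 3 / 3)
              + √3 / a * (ε ^ 2 / 30) * v ^ 2 := fun v => by simp only [hχ]; ring
          simp only [e]
          rw [intervalIntegral.integral_add (by simp) (Continuous.intervalIntegrable (by fun_prop) _ _),
            intervalIntegral.integral_const, intervalIntegral.integral_const_mul, integral_pow]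
          simp only [smul_eq_mul]
          norm_num
          ring
        rw [this]; ring

/-! ### The lower bound for the strong-interaction value -/

theorem ae_norm_mem_shell {a ε : ℝ} (ha : 0 < a) (hε : 0 < ε) :
    ∀ᵐ x ∂(singleParticleLaw 3 (shellDensity a ε)), ‖x‖ ∈ Set.Icc a ((1 + ε) * a) := by
  have hm := measurable_shellDensity a ε
  rw [singleParticleLaw_three, ae_withDensity_iff (by fun_prop)]
  refine Filter.Eventually.of_forall fun x hx => ?_
  refine (shellDensity_ne_zero_iff ha hε).1 fun h => hx ?_
  rw [h]; simp

theorem exists_shellRadius {a ε r : ℝ} (ha : 0 < a) (hε : 0 < ε)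
    (hr : r ∈ Set.Icc a ((1 + ε) * a)) : ∃ u ∈ Set.Icc (0 : ℝ) 1, r = a * (1 + u * ε) := by
  refine ⟨(r / a - 1) / ε, ⟨?_, ?_⟩, ?_⟩
  · have : 1 ≤ r / a := (one_le_div ha).2 hr.1
    exact div_nonneg (by linarith) hε.le
  · have : r / a ≤ 1 + ε := (div_le_iff₀ ha).2 hr.2
    rw [div_le_one hε]; linarith
  · field_simp; ring

theorem le_VSIL_shell {a ε K : ℝ} (ha : 0 < a) (hε : 0 < ε) (hε1 : ε ≤ 1 / 10)
    (hKε : K * ε ^ 3 ≤ 1 / 2)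
    (hcost : ∀ u ∈ Set.Icc (0 : Fin 3 → ℝ) 1, ∀ p : Fin 3 → E3,
      (∀ i, ‖p i‖ = a * shellRadius ε u i) →
        ENNReal.ofReal (√3 / a * (shellQuad ε u - K * ε ^ 3)) ≤ coulombCost p) :
    ENNReal.ofReal (√3 / a * (1 - ε / 2 + 31 / 120 * ε ^ 2 - K * ε ^ 3))
      ≤ VSIL 3 (shellDensity a ε) := by
  refine le_iInf₂ fun γ ⟨_, _, hγ⟩ => ?_
  -- This is a Kantorovich potential: replacing `S ^ 2` by its tangent `3 S - 9 / 4` at the mean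
  -- makes the lower bound a sum of one-body terms. The discarded part is `ε ^ 2 / 10 * (S - 3 / 2)
  -- ^ 2`.
  set φ : ℝ → ℝ := fun v => √3 / a * (1 / 3 - ε * v / 3
    + ε ^ 2 * (v ^ 2 / 30 + 3 * v / 10 - 3 / 40) - K * ε ^ 3 / 3) with hφ
  have hφ0 : ∀ v ∈ Set.Icc (0 : ℝ) 1, 0 ≤ φ v := fun v hv => by
    have h1 : ε * v ≤ 1 / 10 := by nlinarith [hv.1, hv.2]
    have h2 : 0 ≤ ε ^ 2 * (v ^ 2 / 30 + 3 * v / 10) := by have := hv.1; positivity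
    have h3 : ε ^ 2 ≤ 1 / 100 := by nlinarith
    have : 0 ≤ 1 / 3 - ε * v / 3
      + ε ^ 2 * (v ^ 2 / 30 + 3 * v / 10 - 3 / 40) - K * ε ^ 3 / 3 := by nlinarith
    positivity
  have hφc : Continuous φ := by fun_prop
  set g : ℝ → ℝ≥0∞ := fun r => ENNReal.ofReal (φ ((r / a - 1) / ε)) with hg
  have hgm : Measurable g := (hφc.comp (by fun_prop)).measurable.ennreal_ofReal
  have hgu : ∀ u, g (a * (1 + u * ε)) = ENNReal.ofReal (φ u) := fun u => by
    simp only [hg]; congr 2; field_simp; ring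
  have hae : ∀ i, ∀ᵐ p ∂γ, ‖p i‖ ∈ Set.Icc a ((1 + ε) * a) := fun i => by
    have := ae_norm_mem_shell ha hε
    rw [← hγ i] at this
    exact ae_of_ae_map (measurable_pi_apply i).aemeasurable this
  have hle : ∫⁻ p, (g ‖p 0‖ + g ‖p 1‖ + g ‖p 2‖) ∂γ ≤ ∫⁻ p, coulombCost p ∂γ := by
    refine lintegral_mono_ae ?_
    filter_upwards [ae_all_iff.2 hae] with p hp
    choose u hu hpu using fun i => exists_shellRadius ha hε (hp i)
    refine le_trans ?_ (hcost u ⟨fun i => (hu i).1, fun i => (hu i).2⟩ p hpu)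
    simp only [hpu, hgu]
    rw [← ENNReal.ofReal_add (hφ0 _ (hu 0)) (hφ0 _ (hu 1)),
      ← ENNReal.ofReal_add (add_nonneg (hφ0 _ (hu 0)) (hφ0 _ (hu 1))) (hφ0 _ (hu 2))]
    refine ENNReal.ofReal_le_ofReal ?_
    simp only [hφ, ← mul_add]
    refine mul_le_mul_of_nonneg_left ?_ (by positivity)
    have : 0 ≤ ε ^ 2 / 10 * (u 0 + u 1 + u 2 - 3 / 2) ^ 2 := by positivity
    simp only [shellQuad]
    linarith
  have hint : ∀ i, ∫⁻ p, g ‖p i‖ ∂γ = ENNReal.ofReal (∫ v in (0 : ℝ)..1, φ v) := fun i => by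
    rw [← lintegral_map (f := fun x : E3 => g ‖x‖) (by fun_prop) (measurable_pi_apply i), hγ i,
      lintegral_norm_singleParticleLaw ha hε hgm]
    simp only [hgu]
    exact setLIntegral_ofReal_Icc zero_le_one hφc hφ0
  have hgi : ∀ i : Fin 3, Measurable fun p : Fin 3 → E3 => g ‖p i‖ := fun i =>
    hgm.comp (by fun_prop)
  rw [lintegral_add_right _ (hgi 2), lintegral_add_right _ (hgi 1), hint, hint, hint] at hle
  refine le_trans (le_of_eq ?_) hle
  have hI : ∫ v in (0 : ℝ)..1, φ v
      = √3 / a * (1 / 3 - ε / 6 + ε ^ 2 * (1 / 90 + 3 / 40) - K * ε ^ 3 / 3) := by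
    have e : ∀ v, φ v = √3 / a * (1 / 3 - ε ^ 2 * (3 / 40) - K * ε ^ 3 / 3)
        + √3 / a * (3 * ε ^ 2 / 10 - ε / 3) * v + √3 / a * (ε ^ 2 / 30) * v ^ 2 := fun v => by
      simp only [hφ]; ring
    simp only [e]
    rw [intervalIntegral.integral_add (Continuous.intervalIntegrable (by fun_prop) _ _)
        (Continuous.intervalIntegrable (by fun_prop) _ _),
      intervalIntegral.integral_add (by simp) (Continuous.intervalIntegrable (by fun_prop) _ _),
      intervalIntegral.integral_const, intervalIntegral.integral_const_mul,
      intervalIntegral.integral_const_mul, integral_pow, integral_id]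
    simp only [smul_eq_mul]
    norm_num
    ring
  have hI0 : 0 ≤ ∫ v in (0 : ℝ)..1, φ v :=
    intervalIntegral.integral_nonneg zero_le_one hφ0
  rw [← ENNReal.ofReal_add hI0 hI0, ← ENNReal.ofReal_add (add_nonneg hI0 hI0) hI0, hI]
  congr 1; ring

/-! ### The SGS radii in shell coordinates -/

theorem radialCount_shellDensity {a ε r : ℝ} (ha : 0 < a) (hε : 0 < ε)
    (hr : r ∈ Set.Icc a ((1 + ε) * a)) :
    radialCount (shellDensity a ε) r = 3 * (r - a) / (a * ε) := by
  have h : (fun s => 4 * Real.pi * s ^ 2 * shellDensity a ε s)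
      = (Set.Icc a ((1 + ε) * a)).indicator fun _ => 3 / (a * ε) := by
    ext s
    by_cases hs : s ∈ Set.Icc a ((1 + ε) * a)
    · rw [Set.indicator_of_mem hs, radial_shellDensity_eq ha hε hs]
    · rw [Set.indicator_of_notMem hs, shellDensity_eq_zero hs, mul_zero]
  have hset : Set.Ioc 0 r ∩ Set.Icc a ((1 + ε) * a) = Set.Icc a r := by
    ext s
    simp only [Set.mem_inter_iff, Set.mem_Ioc, Set.mem_Icc]
    exact ⟨fun h => ⟨h.2.1, h.1.2⟩, fun h => ⟨⟨ha.trans_le h.1, h.2⟩, h.1, h.2.trans hr.2⟩⟩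
  rw [radialCount, h, intervalIntegral.integral_of_le (ha.le.trans hr.1),
    setIntegral_indicator measurableSet_Icc, hset, setIntegral_const, Measure.real,
    Real.volume_Icc, ENNReal.toReal_ofReal (sub_nonneg.2 hr.1), smul_eq_mul]
  ring

theorem shell_mem_Icc {a ε u : ℝ} (ha : 0 < a) (hε : 0 < ε) (hu : u ∈ Set.Icc (0 : ℝ) 1) :
    a * (1 + u * ε) ∈ Set.Icc a ((1 + ε) * a) := by
  have h1 := mul_nonneg hu.1 hε.le
  have h2 : u * ε ≤ ε := mul_le_of_le_one_left hε.le hu.2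
  constructor <;> nlinarith

theorem radialCount_shell {a ε u : ℝ} (ha : 0 < a) (hε : 0 < ε) (hu : u ∈ Set.Icc (0 : ℝ) 1) :
    radialCount (shellDensity a ε) (a * (1 + u * ε)) = 3 * u := by
  rw [radialCount_shellDensity ha hε (shell_mem_Icc ha hε hu)]
  field_simp; ring

theorem radialQuantile_shell {a ε u : ℝ} (ha : 0 < a) (hε : 0 < ε) (hu : u ∈ Set.Icc (0 : ℝ) 1) :
    radialQuantile (shellDensity a ε) (3 * u) = a * (1 + u * ε) := by
  have hset : {r | 0 ≤ r ∧ shellDensity a ε r ≠ 0} = Set.Icc a ((1 + ε) * a) := by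
    ext r
    simp only [Set.mem_ofPred_eq, shellDensity_ne_zero_iff ha hε]
    exact ⟨fun h => h.2, fun h => ⟨ha.le.trans h.1, h⟩⟩
  have hex : ∃ r ∈ Set.Icc a ((1 + ε) * a), radialCount (shellDensity a ε) r = 3 * u :=
    ⟨_, shell_mem_Icc ha hε hu, radialCount_shell ha hε hu⟩
  rw [radialQuantile, hset]
  have hmem := Function.invFunOn_mem hex
  have heq := Function.invFunOn_eq hex
  rw [radialCount_shellDensity ha hε hmem, div_eq_iff (by positivity)] at heq
  linarith

/-- The shell coordinates of the three electrons in the SGS state. -/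
noncomputable def sgsTriple (u : ℝ) : Fin 3 → ℝ :=
  ![u, |2 / 3 - u|, min (u + 2 / 3) (4 / 3 - u)]

theorem sgsTriple_mem {u : ℝ} (hu : u ∈ Set.Icc (0 : ℝ) 1) :
    sgsTriple u ∈ Set.Icc (0 : Fin 3 → ℝ) 1 := by
  obtain ⟨h0, h1⟩ := hu
  constructor <;> intro i <;> fin_cases i <;>
    simp only [sgsTriple, Fin.mk_one, Fin.zero_eta, Fin.reduceFinMk, Matrix.cons_val,
      Pi.zero_apply, Pi.one_apply]
  · exact h0
  · exact abs_nonneg _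
  · exact le_min (by linarith) (by linarith)
  · exact h1
  · exact abs_le.2 ⟨by linarith, by linarith⟩
  · rcases le_total u (1 / 3) with h | h
    · exact (min_le_left _ _).trans (by linarith)
    · exact (min_le_right _ _).trans (by linarith)

theorem continuous_sgsTriple : Continuous sgsTriple := by
  refine continuous_pi fun i => ?_
  fin_cases i
  · exact continuous_id
  · exact (continuous_const.sub continuous_id).abs
  · exact (continuous_id.add continuous_const).min (continuous_const.sub continuous_id)

theorem sgsRadii_shell {a ε u : ℝ} (ha : 0 < a) (hε : 0 < ε) (hu : u ∈ Set.Icc (0 : ℝ) 1) :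
    sgsRadii 3 (shellDensity a ε) (a * (1 + u * ε))
      = fun i => a * shellRadius ε (sgsTriple u) i := by
  obtain ⟨h0, h1⟩ := hu
  have hN := radialCount_shell ha hε ⟨h0, h1⟩
  have hR : ∀ {ν : ℝ} (v : ℝ), ν = 3 * v → 0 ≤ v → v ≤ 1 →
      radialQuantile (shellDensity a ε) ν = a * (1 + v * ε) := fun v h hv0 hv1 => by
    rw [h]; exact radialQuantile_shell ha hε ⟨hv0, hv1⟩
  have hle : ∀ {v w : ℝ}, a * (1 + v * ε) ≤ a * (1 + w * ε) ↔ v ≤ w := fun {v w} => by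
    rw [mul_le_mul_iff_right₀ ha, add_le_add_iff_left, mul_le_mul_iff_left₀ hε]
  have hlt : ∀ {v w : ℝ}, a * (1 + v * ε) < a * (1 + w * ε) ↔ v < w := fun {v w} => by
    rw [mul_lt_mul_iff_right₀ ha, add_lt_add_iff_left, mul_lt_mul_iff_left₀ hε]
  funext i
  fin_cases i
  · change sgsRadial 3 (shellDensity a ε) 1 _ = a * (1 + u * ε)
    rw [sgsRadial, if_neg (by decide), hN, hR 1 (by norm_num) zero_le_one le_rfl]
    split_ifs with h
    · exact hR u (by push_cast; ring) h0 h1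
    -- For `n = 1` the switching radius is the outer one, so the second branch occurs only at `u =
    -- 1`, where both branches agree.
    · have : u = 1 := le_antisymm h1 (not_lt.1 fun h' => h (hlt.2 h'))
      rw [hR 1 (by rw [this]; norm_num) zero_le_one le_rfl, this]
  · change sgsRadial 3 (shellDensity a ε) 2 _ = a * (1 + |2 / 3 - u| * ε)
    rw [sgsRadial, if_pos (by decide), hN, hR (2 / 3) (by norm_num) (by norm_num) (by norm_num)]
    split_ifs with h <;> rw [hle] at h
    · rw [abs_of_nonneg (by linarith)]
      exact hR _ (by push_cast; ring) (by linarith) (by linarith)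
    · rw [abs_of_nonpos (by linarith)]
      exact hR _ (by push_cast; ring) (by linarith) (by linarith)
  · change sgsRadial 3 (shellDensity a ε) 3 _ = a * (1 + min (u + 2 / 3) (4 / 3 - u) * ε)
    rw [sgsRadial, if_neg (by decide), hN, hR (1 / 3) (by norm_num) (by norm_num) (by norm_num)]
    split_ifs with h <;> rw [hlt] at h
    · rw [min_eq_left (by linarith)]
      exact hR _ (by push_cast; ring) (by linarith) (by linarith)
    · rw [min_eq_right (by linarith)]
      exact hR _ (by push_cast; ring) (by linarith) (by linarith)

/-! ### The SGS value -/

theorem VSGS_shell {a ε : ℝ} (ha : 0 < a) (hε : 0 < ε) :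
    VSGS 3 (shellDensity a ε) = ∫⁻ u in Set.Icc (0 : ℝ) 1,
      reducedCost (fun i => a * shellRadius ε (sgsTriple u) i) := by
  have := lintegral_radial_shell ha hε fun r => reducedCost (sgsRadii 3 (shellDensity a ε) r)
  rw [VSGS, Nat.cast_ofNat, this]
  exact setLIntegral_congr_fun measurableSet_Icc fun u hu => by
    simp only [sgsRadii_shell ha hε hu]

theorem integral_quadratic (A B C c d : ℝ) :
    ∫ v in c..d, (A + B * v + C * v ^ 2)
      = A * (d - c) + B * ((d ^ 2 - c ^ 2) / 2) + C * ((d ^ 3 - c ^ 3) / 3) := by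
  rw [intervalIntegral.integral_add (Continuous.intervalIntegrable (by fun_prop) _ _)
      (Continuous.intervalIntegrable (by fun_prop) _ _),
    intervalIntegral.integral_add (by simp) (Continuous.intervalIntegrable (by fun_prop) _ _),
    intervalIntegral.integral_const, intervalIntegral.integral_const_mul,
    intervalIntegral.integral_const_mul, integral_pow, integral_id]
  simp only [smul_eq_mul]
  norm_num
  ring

theorem continuous_shellQuad_sgsTriple (ε : ℝ) : Continuous fun u => shellQuad ε (sgsTriple u) := by
  have h := fun i => (continuous_apply i).comp continuous_sgsTriple
  have h0 : Continuous fun u => sgsTriple u 0 := h 0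
  have h1 : Continuous fun u => sgsTriple u 1 := h 1
  have h2 : Continuous fun u => sgsTriple u 2 := h 2
  simp only [shellQuad]
  fun_prop

/-- The sum of the coordinates is `4 / 3 + u`, `2 - u` and `2 / 3 + u` on the successive thirds of
`[0, 1]`, where the absolute value and the minimum change branch. -/
theorem integral_shellQuad_sgsTriple (ε : ℝ) :
    ∫ u in (0 : ℝ)..1, shellQuad ε (sgsTriple u) = 1 - ε / 2 + 7 / 27 * ε ^ 2 := by
  have hc := continuous_shellQuad_sgsTriple ε
  rw [← intervalIntegral.integral_add_adjacent_intervals (hc.intervalIntegrable 0 (1 / 3))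
      (hc.intervalIntegrable (1 / 3) 1),
    ← intervalIntegral.integral_add_adjacent_intervals (hc.intervalIntegrable (1 / 3) (2 / 3))
      (hc.intervalIntegrable (2 / 3) 1)]
  have e1 : ∫ u in (0 : ℝ)..(1 / 3), shellQuad ε (sgsTriple u)
      = ∫ u in (0 : ℝ)..(1 / 3), ((1 - 4 * ε / 9 + ε ^ 2 * (8 / 270 + 16 / 90))
        + (-ε / 3 + ε ^ 2 * (8 / 30)) * u + ε ^ 2 / 5 * u ^ 2) := by
    refine intervalIntegral.integral_congr fun u hu => ?_
    rw [Set.uIcc_of_le (by norm_num)] at hu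
    simp only [shellQuad, sgsTriple, Matrix.cons_val]
    rw [abs_of_nonneg (by linarith [hu.2]), min_eq_left (by linarith [hu.2])]
    ring
  have e2 : ∫ u in (1 / 3 : ℝ)..(2 / 3), shellQuad ε (sgsTriple u)
      = ∫ u in (1 / 3 : ℝ)..(2 / 3), ((1 - 2 * ε / 3 + ε ^ 2 * (20 / 270 + 4 / 10))
        + (ε / 3 - ε ^ 2 * (16 / 30)) * u + ε ^ 2 / 5 * u ^ 2) := by
    refine intervalIntegral.integral_congr fun u hu => ?_
    rw [Set.uIcc_of_le (by norm_num)] at hu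
    simp only [shellQuad, sgsTriple, Matrix.cons_val]
    rw [abs_of_nonneg (by linarith [hu.2]), min_eq_right (by linarith [hu.1])]
    ring
  have e3 : ∫ u in (2 / 3 : ℝ)..1, shellQuad ε (sgsTriple u)
      = ∫ u in (2 / 3 : ℝ)..1, ((1 - 2 * ε / 9 + ε ^ 2 * (20 / 270 + 4 / 90))
        + (-ε / 3) * u + ε ^ 2 / 5 * u ^ 2) := by
    refine intervalIntegral.integral_congr fun u hu => ?_
    rw [Set.uIcc_of_le (by norm_num)] at hu
    simp only [shellQuad, sgsTriple, Matrix.cons_val]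
    rw [abs_of_nonpos (by linarith [hu.1]), min_eq_right (by linarith [hu.1])]
    ring
  rw [e1, e2, e3, integral_quadratic, integral_quadratic, integral_quadratic]
  ring

theorem lintegral_shellQuad_sgsTriple {a ε c : ℝ} (ha : 0 < a) (hε : 0 < ε) (hε1 : ε ≤ 1 / 10)
    (hc : |c| ≤ 1 / 2) :
    ∫⁻ u in Set.Icc (0 : ℝ) 1, ENNReal.ofReal (√3 / a * (shellQuad ε (sgsTriple u) + c))
      = ENNReal.ofReal (√3 / a * (1 - ε / 2 + 7 / 27 * ε ^ 2 + c)) := by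
  have hq := continuous_shellQuad_sgsTriple ε
  rw [setLIntegral_ofReal_Icc zero_le_one (by fun_prop) fun u hu => ?_]
  · rw [intervalIntegral.integral_const_mul, intervalIntegral.integral_add
      (hq.intervalIntegrable _ _) (by simp), integral_shellQuad_sgsTriple]
    simp
  · have h := (sgsTriple_mem hu).2
    have h0 : sgsTriple u 0 ≤ 1 := h 0
    have h1 : sgsTriple u 1 ≤ 1 := h 1
    have h2 : sgsTriple u 2 ≤ 1 := h 2
    have h3 : ε * (sgsTriple u 0 + sgsTriple u 1 + sgsTriple u 2) ≤ ε * 3 :=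
      mul_le_mul_of_nonneg_left (by linarith) hε.le
    have h4 : 0 ≤ ε ^ 2 * ((sgsTriple u 0 ^ 2 + sgsTriple u 1 ^ 2 + sgsTriple u 2 ^ 2) / 30
      + (sgsTriple u 0 + sgsTriple u 1 + sgsTriple u 2) ^ 2 / 10) := by positivity
    have : 0 ≤ shellQuad ε (sgsTriple u) + c := by
      simp only [shellQuad]; linarith [(abs_le.1 hc).1]
    positivity

theorem VSGS_shell_le {a ε K : ℝ} (ha : 0 < a) (hε : 0 < ε) (hε1 : ε ≤ 1 / 10)
    (hK : |K * ε ^ 3| ≤ 1 / 2)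
    (hcost : ∀ u ∈ Set.Icc (0 : Fin 3 → ℝ) 1,
      coulombCost (shellConfig a ε u) ≤ ENNReal.ofReal (√3 / a * (shellQuad ε u + K * ε ^ 3))) :
    VSGS 3 (shellDensity a ε)
      ≤ ENNReal.ofReal (√3 / a * (1 - ε / 2 + 7 / 27 * ε ^ 2 + K * ε ^ 3)) := by
  rw [VSGS_shell ha hε, ← lintegral_shellQuad_sgsTriple ha hε hε1 hK]
  refine setLIntegral_mono' measurableSet_Icc fun u hu => ?_
  refine le_trans ?_ (hcost _ (sgsTriple_mem hu))
  exact iInf₂_le (shellConfig a ε (sgsTriple u))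
    (norm_shellConfig ha ⟨hε.le, hε1⟩ (sgsTriple_mem hu))

theorem le_VSGS_shell {a ε K : ℝ} (ha : 0 < a) (hε : 0 < ε) (hε1 : ε ≤ 1 / 10)
    (hK : |K * ε ^ 3| ≤ 1 / 2)
    (hcost : ∀ u ∈ Set.Icc (0 : Fin 3 → ℝ) 1, ∀ p : Fin 3 → E3,
      (∀ i, ‖p i‖ = a * shellRadius ε u i) →
        ENNReal.ofReal (√3 / a * (shellQuad ε u - K * ε ^ 3)) ≤ coulombCost p) :
    ENNReal.ofReal (√3 / a * (1 - ε / 2 + 7 / 27 * ε ^ 2 - K * ε ^ 3))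
      ≤ VSGS 3 (shellDensity a ε) := by
  rw [VSGS_shell ha hε, sub_eq_add_neg,
    ← lintegral_shellQuad_sgsTriple ha hε hε1 (c := -(K * ε ^ 3)) (by rwa [abs_neg])]
  refine setLIntegral_mono' measurableSet_Icc fun u hu => ?_
  rw [← sub_eq_add_neg]
  exact le_iInf₂ fun p hp => hcost _ (sgsTriple_mem hu) p hp

/-! ### Existence and cost of SGS co-motion maps -/

theorem continuous_coulombCost_three : Continuous (coulombCost : (Fin 3 → E3) → ℝ≥0∞) := by
  simp only [funext coulombCost_three]
  fun_prop

theorem coulombCost_comp_isometry {N : ℕ} (e : E3 ≃ₗᵢ[ℝ] E3) (p : Fin N → E3) :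
    coulombCost (fun i => e (p i)) = coulombCost p := by
  simp only [coulombCost, e.isometry.edist_eq]

/-- A minimiser exists by compactness of the product of spheres; a reflection, which preserves the
cost, then moves its first point to `x`. -/
theorem exists_coulombCost_minimizer {r : Fin 3 → ℝ} (hr : ∀ i, 0 ≤ r i) {x : E3}
    (hx : ‖x‖ = r 0) :
    ∃ p : Fin 3 → E3, p 0 = x ∧ (∀ i, ‖p i‖ = r i) ∧
      ∀ q : Fin 3 → E3, (∀ i, ‖q i‖ = r i) → coulombCost p ≤ coulombCost q := by
  have hcomp : IsCompact (Set.univ.pi fun i => Metric.sphere (0 : E3) (r i)) :=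
    isCompact_univ_pi fun i => isCompact_sphere 0 (r i)
  have hmem : ∀ p : Fin 3 → E3,
      p ∈ (Set.univ.pi fun i => Metric.sphere (0 : E3) (r i)) ↔ ∀ i, ‖p i‖ = r i := by
    simp
  obtain ⟨p, hp, hmin⟩ := hcomp.exists_isMinOn
    ⟨fun i => r i • EuclideanSpace.single 0 1, (hmem _).2 fun i => by
      simp [norm_smul, abs_of_nonneg (hr i)]⟩ continuous_coulombCost_three.continuousOn
  rw [hmem] at hp
  set e : E3 ≃ₗᵢ[ℝ] E3 := (ℝ ∙ (p 0 - x))ᗮ.reflection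
  refine ⟨fun i => e (p i), Submodule.reflection_sub ((hp 0).trans hx.symm),
    fun i => (e.norm_map _).trans (hp i), fun q hq => ?_⟩
  rw [coulombCost_comp_isometry]
  exact hmin ((hmem q).2 hq)

theorem sgsRadii_nonneg_and_head {a ε : ℝ} (ha : 0 < a) (hε : 0 < ε) {x : E3}
    (hx : shellDensity a ε ‖x‖ ≠ 0) :
    (∀ i, 0 ≤ sgsRadii 3 (shellDensity a ε) ‖x‖ i) ∧ ‖x‖ = sgsRadii 3 (shellDensity a ε) ‖x‖ 0 := by
  obtain ⟨u, hu, hxu⟩ := exists_shellRadius ha hε ((shellDensity_ne_zero_iff ha hε).1 hx)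
  rw [hxu, sgsRadii_shell ha hε hu]
  exact ⟨fun i => mul_nonneg ha.le
    (zero_le_one.trans (shellRadius_mem hε.le (sgsTriple_mem hu) i).1), rfl⟩

theorem exists_isSGSComotion {a ε : ℝ} (ha : 0 < a) (hε : 0 < ε) :
    ∃ F : E3 → Fin 3 → E3, IsSGSComotion 3 (shellDensity a ε) F := by
  have : ∀ x : E3, ∃ p : Fin 3 → E3, shellDensity a ε ‖x‖ ≠ 0 →
      p 0 = x ∧ (∀ i, ‖p i‖ = sgsRadii 3 (shellDensity a ε) ‖x‖ i) ∧
      ∀ q : Fin 3 → E3, (∀ i, ‖q i‖ = sgsRadii 3 (shellDensity a ε) ‖x‖ i) →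
        coulombCost p ≤ coulombCost q := fun x => by
    by_cases hx : shellDensity a ε ‖x‖ = 0
    · exact ⟨0, fun h => absurd hx h⟩
    · obtain ⟨h1, h2⟩ := sgsRadii_nonneg_and_head ha hε hx
      obtain ⟨p, hp⟩ := exists_coulombCost_minimizer h1 h2
      exact ⟨p, fun _ => hp⟩
  choose F hF using this
  refine ⟨F, fun x hx => ⟨fun i hi => ?_, (hF x hx).2⟩⟩
  rw [show i = 0 from Fin.ext hi]
  exact (hF x hx).1

/-- The reduced cost, as an infimum over directions. -/
noncomputable def directionalCost (r : Fin 3 → ℝ) : ℝ≥0∞ :=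
  ⨅ e ∈ {e : Fin 3 → E3 | ∀ i, ‖e i‖ = 1}, coulombCost fun i => r i • e i

/-- Parametrising by directions makes the feasible set independent of `r`, so the infimum of
continuous functions is upper semicontinuous. -/
theorem measurable_directionalCost : Measurable directionalCost := by
  refine UpperSemicontinuous.measurable (upperSemicontinuous_biInf fun e _ => ?_)
  refine Continuous.upperSemicontinuous (continuous_coulombCost_three.comp ?_)
  fun_prop

theorem directionalCost_eq_reducedCost {r : Fin 3 → ℝ} (hr : ∀ i, 0 < r i) :
    directionalCost r = reducedCost r := by
  refine le_antisymm (le_iInf₂ fun p hp => ?_) (le_iInf₂ fun e he => ?_)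
  · refine (iInf₂_le (fun i => (r i)⁻¹ • p i) fun i => ?_).trans_eq ?_
    · rw [norm_smul, hp i, norm_inv, Real.norm_of_nonneg (hr i).le, inv_mul_cancel₀ (hr i).ne']
    · simp only [smul_inv_smul₀ (hr _).ne']
  · refine iInf₂_le (fun i => r i • e i) fun i => ?_
    rw [norm_smul, he i, mul_one, Real.norm_of_nonneg (hr i).le]

/-- Minimality makes the cost along `F` equal to the reduced cost, a function of `‖x‖` alone, so `F`
itself need not be measurable. The representative `g` through `directionalCost` supplies the
measurability for polar coordinates. -/
theorem sceValue_eq_VSGS {a ε : ℝ} (ha : 0 < a) (hε : 0 < ε) {F : E3 → Fin 3 → E3}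
    (hF : IsSGSComotion 3 (shellDensity a ε) F) :
    sceValue 3 (shellDensity a ε) F = VSGS 3 (shellDensity a ε) := by
  set g : ℝ → ℝ≥0∞ := fun r =>
    directionalCost fun i => a * shellRadius ε (sgsTriple ((r / a - 1) / ε)) i with hg
  have hgm : Measurable g := by
    refine measurable_directionalCost.comp (measurable_pi_lambda _ fun i => ?_)
    have h : Measurable fun r : ℝ => sgsTriple ((r / a - 1) / ε) i :=
      (measurable_pi_apply i).comp (continuous_sgsTriple.measurable.comp (by fun_prop))
    simp only [shellRadius]
    fun_prop
  have hgu : ∀ u ∈ Set.Icc (0 : ℝ) 1, g (a * (1 + u * ε))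
      = reducedCost fun i => a * shellRadius ε (sgsTriple u) i := fun u hu => by
    have e : (a * (1 + u * ε) / a - 1) / ε = u := by field_simp; ring
    simp only [hg, e]
    exact directionalCost_eq_reducedCost fun i => mul_pos ha
      (zero_lt_one.trans_le (shellRadius_mem hε.le (sgsTriple_mem hu) i).1)
  have hFg : ∀ x : E3, ENNReal.ofReal (shellDensity a ε ‖x‖ / 3) * coulombCost (F x)
      = ENNReal.ofReal (shellDensity a ε ‖x‖ / 3) * g ‖x‖ := fun x => by
    by_cases hx : shellDensity a ε ‖x‖ = 0
    · simp [hx]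
    · obtain ⟨u, hu, hxu⟩ := exists_shellRadius ha hε ((shellDensity_ne_zero_iff ha hε).1 hx)
      obtain ⟨-, h2, h3⟩ := hF x hx
      have : coulombCost (F x) = reducedCost (sgsRadii 3 (shellDensity a ε) ‖x‖) :=
        le_antisymm (le_iInf₂ fun q hq => h3 q hq) (iInf₂_le (F x) h2)
      rw [this, hxu, hgu u hu, sgsRadii_shell ha hε hu]
  rw [VSGS_shell ha hε, sceValue, Nat.cast_ofNat]
  simp_rw [hFg]
  rw [lintegral_norm_shell ha hε hgm]
  exact setLIntegral_congr_fun measurableSet_Icc hgu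

/-! ### Assembly of the bounds -/

theorem toReal_mem_Icc_of_ofReal_le {V : ℝ≥0∞} {x y : ℝ} (hx : ENNReal.ofReal x ≤ V)
    (hy : V ≤ ENNReal.ofReal y) (h0 : 0 ≤ y) : V ≠ ∞ ∧ x ≤ V.toReal ∧ V.toReal ≤ y := by
  have hV : V ≠ ∞ := ne_top_of_le_ne_top ENNReal.ofReal_ne_top hy
  exact ⟨hV, (ENNReal.ofReal_le_iff_le_toReal hV).1 hx, ENNReal.toReal_le_of_le_ofReal h0 hy⟩

theorem mainTheorem2 :
    ∃ C ε₀ : ℝ, 0 < ε₀ ∧ ∀ a ε : ℝ, 0 < a → 0 < ε → ε < ε₀ →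
      |(VSGS 3 (shellDensity a ε)).toReal
          - √3 / a * (1 - ε / 2 + 7 / 27 * ε ^ 2)| ≤ √3 / a * (C * ε ^ 3) ∧
      |(VSIL 3 (shellDensity a ε)).toReal
          - √3 / a * (1 - ε / 2 + 31 / 120 * ε ^ 2)| ≤ √3 / a * (C * ε ^ 3) ∧
      |(VSGS 3 (shellDensity a ε)).toReal
          - ((VSIL 3 (shellDensity a ε)).toReal + √3 / 1080 * (ε ^ 2 / a))|
        ≤ √3 / a * (C * ε ^ 3) ∧
      VSGS 3 (shellDensity a ε) ≠ ∞ ∧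
      VSIL 3 (shellDensity a ε) < VSGS 3 (shellDensity a ε) ∧
      (∃ F : E3 → Fin 3 → E3, IsSGSComotion 3 (shellDensity a ε) F) ∧
      ∀ F : E3 → Fin 3 → E3, IsSGSComotion 3 (shellDensity a ε) F →
        sceValue 3 (shellDensity a ε) F = VSGS 3 (shellDensity a ε) ∧
        VSIL 3 (shellDensity a ε) < sceValue 3 (shellDensity a ε) F := by
  obtain ⟨K, ε₁, hK, hε₁, hε₁10, hcost⟩ := shell_cost_bounds
  -- Comparing the two values doubles the error `K ε ^ 3`. The bound `2160 K ε < 1` makes `2 K ε ^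
  -- 3` smaller than the gap `ε ^ 2 / 1080`.
  refine ⟨2 * K, min ε₁ (1 / (2160 * (K + 1))), lt_min hε₁ (by positivity), ?_⟩
  intro a ε ha hε hε0
  have hε1 := hε0.trans_le (min_le_left _ _)
  have hε2 := hε0.trans_le (min_le_right _ _)
  rw [lt_div_iff₀ (by positivity)] at hε2
  have hε10 : ε ≤ 1 / 10 := hε1.le.trans hε₁10
  have hKε : 2160 * (K * ε) < 1 := by nlinarith
  have hε2' : 0 < ε ^ 2 := by positivity
  have hK3 : 2160 * (K * ε ^ 3) < ε ^ 2 := by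
    have := mul_lt_mul_of_pos_right hKε hε2'
    linarith
  have hK0 : 0 ≤ K * ε ^ 3 := by positivity
  have hsq : ε ^ 2 ≤ 1 := by nlinarith
  have hKabs : |K * ε ^ 3| ≤ 1 / 2 := by rw [abs_of_nonneg hK0]; linarith
  have hup := fun u hu => (hcost a ε ha hε hε1 u hu).1
  have hlow := fun u hu => (hcost a ε ha hε hε1 u hu).2
  have hs : 0 < √3 / a := by positivity
  have sgs1 := le_VSGS_shell ha hε hε10 hKabs hlow
  have sgs2 := VSGS_shell_le ha hε hε10 hKabs hup
  have sil1 := le_VSIL_shell ha hε hε10 (abs_le.1 hKabs).2 hlow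
  have sil2 := VSIL_shell_le ha hε hε10 hK hup
  have hlt : VSIL 3 (shellDensity a ε) < VSGS 3 (shellDensity a ε) := by
    refine sil2.trans_lt (lt_of_lt_of_le ?_ sgs1)
    rw [ENNReal.ofReal_lt_ofReal_iff (mul_pos hs (by linarith))]
    exact mul_lt_mul_of_pos_left (by linarith) hs
  obtain ⟨hfin, g1, g2⟩ := toReal_mem_Icc_of_ofReal_le sgs1 sgs2 (mul_nonneg hs.le (by linarith))
  obtain ⟨-, l1, l2⟩ := toReal_mem_Icc_of_ofReal_le sil1 sil2 (mul_nonneg hs.le (by linarith))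
  have hsK : 0 ≤ √3 / a * (K * ε ^ 3) := mul_nonneg hs.le hK0
  have e : √3 / 1080 * (ε ^ 2 / a) = √3 / a * (ε ^ 2 / 1080) := by ring
  refine ⟨?_, ?_, ?_, hfin, hlt, exists_isSGSComotion ha hε, fun F hF => ?_⟩
  · rw [abs_le]; constructor <;> linarith
  · rw [abs_le]; constructor <;> linarith
  · rw [e, abs_le]; constructor <;> linarith
  · rw [sceValue_eq_VSGS ha hε hF]
    exact ⟨rfl, hlt⟩
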